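/- **Hyperfields.** A *hyperfield* $F$ is a commutative monoid $(F,\cdot,1)$ with an element $0\neq 1$ such that $0\cdot x=0$ for all $x$ and every nonzero element is invertible, together with a commutative and associative hyperaddition $\boxplus$ assigning to $x,y\in F$ a non-empty subset $x\boxplus y\subseteq F$, such that $0\boxplus x=\{x\}$; for each $x$ there is a unique element $-x$ with $0\in x\boxplus(-x)$; $x\in y\boxplus z$ if and only if $z\in x\boxplus(-y)$; and $a(x\boxplus y)=ax\boxplus ay$. Associativity means $\bigcup_{w\in y\boxplus z}x\boxplus w=\bigcup_{w\in x\boxplus y}w\boxplus z$. Set $F^\times=F\setminus\{0\}$, and define iterated hypersums recursively by $x_1\boxplus\cdots\boxplus x_m=\bigcup_{x'\in x_2\boxplus\cdots\boxplus x_m}x_1\boxplus x'$. **Weak $F$-matroids.** Let $E$ be a non-empty finite set. For $X\in F^E$ let $\underline X=\{e\in E: X(e)\neq 0\}$. Two distinct members $C_1,C_2$ of a family of subsets of $E$ form a *modular pair* in it if $C_1\cup C_2$ does not properly contain a union of two distinct members of the family. A *weak $F$-matroid* $M$ on $E$ is given by a set $\mathcal C\subseteq F^E$ (its $F$-circuits)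 such that: * (C0) $0\notin\mathcal C$. * (C1) If $X\in\mathcal C$ and $\alpha\in F^\times$, then $\alpha X\in\mathcal C$. * (C2) If $X,Y\in\mathcal C$ and $\underline X\subseteq\underline Y$, then $X=\alpha Y$ for some $\alpha\in F^\times$. * (C3)$'$ If $X,Y\in\mathcal C$ are such that $\underline X,\underline Y$ form a modular pair in $\{\underline Z: Z\in\mathcal C\}$, and $e\in E$ satisfies $X(e)=-Y(e)\neq 0$, then there is $Z\in\mathcal C$ with $Z(e)=0$ and $Z(f)\in X(f)\boxplus Y(f)$ for all $f\in E$. The sets $\underline X$, $X\in\mathcal C$, are then the circuits of a matroid $\underline M$ on $E$, the *underlying matroid*; the *rank* of $M$ is the rank of $\underline M$. **Weak Grassmann–Plücker functions.** Let $r$ be a positive integer. A *weak Grassmann–Plücker function of rank $r$ on $E$ with coefficients in $F$* is a function $\varphi:E^r\to F$ that is not identically zero; is alternating (exchanging two arguments replaces the value by its hyperinverse, and the value is $0$ if two arguments coincide); is such that the sets $\{x_1,\dots,x_r\}$ with $\varphi(x_1,\dots,x_r)\neq 0$ are exactly the bases of a rank $r$ matroid $\underline M_\varphi$ on $E$; and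 satisfies * (GP3)$'$ for any two subsets $I=\{x_1,\dots,x_{r+1}\}$ (of size $r+1$) and $J=\{y_1,\dots,y_{r-1}\}$ (of size $r-1$) of $E$ with $|I\setminus J|=3$, $$0\in(-1)^1\varphi(\hat x_1,x_2,\dots,x_{r+1})\,\varphi(x_1,y_1,\dots,y_{r-1})\boxplus\cdots\boxplus(-1)^{r+1}\varphi(x_1,\dots,x_r,\hat x_{r+1})\,\varphi(x_{r+1},y_1,\dots,y_{r-1}),$$ where $\hat x_k$ means that $x_k$ is omitted. Two such functions $\varphi_1,\varphi_2$ are *equivalent* if $\varphi_1=\alpha\varphi_2$ for some $\alpha\in F^\times$. For such a $\varphi$, let $\mathcal C_\varphi$ be the set of all $X\in F^E$ such that $\underline X$ is a circuit of $\underline M_\varphi$ and $$\frac{X(f)}{X(e)}=-\frac{\varphi(e,x_2,\dots,x_r)}{\varphi(f,x_2,\dots,x_r)}$$ for all $e,f\in E$ and every basis $\{f,x_2,\dots,x_r\}$ of $\underline M_\varphi$ containing $\underline X\setminus\{e\}$. **Theorem 3.17.** Let $E$ be a non-empty finite set, let $F$ be a hyperfield, and let $r$ be a positive integer. There is a bijection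 between equivalence classes of weak Grassmann–Plücker functions of rank $r$ on $E$ with coefficients in $F$ and weak $F$-matroids of rank $r$ on $E$, which sends the class of $\varphi$ to the weak $F$-matroid whose set of $F$-circuits is $\mathcal C_\varphi$; the underlying matroid of that weak $F$-matroid is $\underline M_\varphi$. -/

import Mathlib

/-- A (commutative) hyperfield: a commutative group with zero (so multiplication is a commutative
monoid, `0` is absorbing, `0 ≠ 1` and every nonzero element is invertible), with a commutative and
associative hyperaddition `hadd` with non-empty values, additive identity `0`, unique hyperinverses
`-x`, reversibility, and distributivity of multiplication over hyperaddition. -/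
class Hyperfield (F : Type*) extends CommGroupWithZero F, Neg F where
  /-- The hypersum `x ⊞ y` of two elements. -/
  hadd : F → F → Set F
  hadd_nonempty : ∀ x y, (hadd x y).Nonempty
  hadd_comm : ∀ x y, hadd x y = hadd y x
  hadd_assoc : ∀ x y z, (⋃ w ∈ hadd y z, hadd x w) = ⋃ w ∈ hadd x y, hadd w z
  zero_hadd : ∀ x, hadd 0 x = {x}
  zero_mem_hadd_neg : ∀ x, (0 : F) ∈ hadd x (-x)
  eq_neg_of_zero_mem_hadd : ∀ x y, (0 : F) ∈ hadd x y → y = -x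
  mem_hadd_iff : ∀ x y z, x ∈ hadd y z ↔ z ∈ hadd x (-y)
  mul_hadd : ∀ a x y, (fun t => a * t) '' hadd x y = hadd (a * x) (a * y)

namespace HyperfieldMatroid

open Hyperfield

/-- The iterated hypersum `x₁ ⊞ ⋯ ⊞ xₘ = ⋃_{x' ∈ x₂ ⊞ ⋯ ⊞ xₘ} x₁ ⊞ x'` of a list
(`{0}` for the empty list, hence `x ⊞ 0 = {x}` for a one-element list). -/
def hsum {F : Type*} [Hyperfield F] : List F → Set F
  | [] => {0}
  | x :: l => ⋃ x' ∈ hsum l, hadd x x'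

/-! ### Modular pairs and circuit elimination -/

/-- `C₁` and `C₂` form a modular pair in the family `S` of sets: they are distinct members of `S`
and `C₁ ∪ C₂` does not properly contain a union of two distinct members of `S`. -/
def IsModularPair {E : Type*} (S : Set (Set E)) (C₁ C₂ : Set E) : Prop :=
  C₁ ∈ S ∧ C₂ ∈ S ∧ C₁ ≠ C₂ ∧ ∀ A ∈ S, ∀ B ∈ S, A ≠ B → ¬ A ∪ B ⊂ C₁ ∪ C₂

/-- Elimination for modular pairs implies elimination for all pairs of distinct members. -/
theorem elimination_of_modular {E : Type*} [Finite E] {S : Set (Set E)}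
    (h : ∀ C₁ C₂, IsModularPair S C₁ C₂ → ∀ e ∈ C₁ ∩ C₂, ∃ C₃ ∈ S, C₃ ⊆ (C₁ ∪ C₂) \ {e}) :
    ∀ C₁ ∈ S, ∀ C₂ ∈ S, C₁ ≠ C₂ → ∀ e ∈ C₁ ∩ C₂, ∃ C₃ ∈ S, C₃ ⊆ (C₁ ∪ C₂) \ {e} := by
  suffices H : ∀ n : ℕ, ∀ C₁ ∈ S, ∀ C₂ ∈ S, (C₁ ∪ C₂).ncard = n → C₁ ≠ C₂ →
      ∀ e ∈ C₁ ∩ C₂, ∃ C₃ ∈ S, C₃ ⊆ (C₁ ∪ C₂) \ {e} from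
    fun C₁ h₁ C₂ h₂ hne e he => H _ C₁ h₁ C₂ h₂ rfl hne e he
  intro n
  induction n using Nat.strong_induction_on with
  | _ n ih =>
    intro C₁ h₁ C₂ h₂ hn hne e he
    by_cases hm : IsModularPair S C₁ C₂
    · exact h C₁ C₂ hm e he
    · simp only [IsModularPair, not_and, not_forall, not_not] at hm
      obtain ⟨A, hA, B, hB, hAB, hlt⟩ := hm h₁ h₂ hne
      by_cases heA : e ∈ A
      · by_cases heB : e ∈ B
        · obtain ⟨C, hC, hCs⟩ := ih _ (hn ▸ Set.ncard_lt_ncard hlt (Set.toFinite _))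
            A hA B hB rfl hAB e ⟨heA, heB⟩
          exact ⟨C, hC, hCs.trans (Set.sdiff_subset_sdiff_left hlt.subset)⟩
        · exact ⟨B, hB, fun x hx => ⟨hlt.subset (Or.inr hx), fun hxe => heB (hxe ▸ hx)⟩⟩
      · exact ⟨A, hA, fun x hx => ⟨hlt.subset (Or.inl hx), fun hxe => heA (hxe ▸ hx)⟩⟩

/-- Sets containing no member of a family with circuit elimination can be augmented. -/
theorem augmentation_of_elimination {E : Type*} [Finite E] {S : Set (Set E)}
    (h : ∀ C₁ ∈ S, ∀ C₂ ∈ S, C₁ ≠ C₂ → ∀ e ∈ C₁ ∩ C₂, ∃ C₃ ∈ S, C₃ ⊆ (C₁ ∪ C₂) \ {e})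
    {I J : Set E} (hI : ∀ C ∈ S, ¬ C ⊆ I) (hJ : ∀ C ∈ S, ¬ C ⊆ J) (hlt : I.ncard < J.ncard) :
    ∃ e ∈ J, e ∉ I ∧ ∀ C ∈ S, ¬ C ⊆ insert e I := by
  by_contra hcon
  push Not at hcon
  suffices H : ∀ n : ℕ, ∀ K : Set E, K ⊆ I ∪ J → (∀ C ∈ S, ¬ C ⊆ K) → I.ncard < K.ncard →
      (I \ K).ncard = n → False from
    H _ J Set.subset_union_right hJ hlt rfl
  intro n
  induction n using Nat.strong_induction_on with
  | _ n ih =>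
    intro K hKIJ hK hIK hn
    have hKI : (K \ I).Nonempty := by
      rw [Set.nonempty_iff_ne_empty, Ne, Set.sdiff_eq_empty]
      exact fun hs => absurd (Set.ncard_le_ncard hs (Set.toFinite _)) (by omega)
    obtain ⟨g, hgK, hgI⟩ := hKI
    by_cases hs : I ⊆ K
    · obtain ⟨C, hC, hCs⟩ := hcon g ((hKIJ hgK).resolve_left hgI) hgI
      exact hK C hC (hCs.trans (Set.insert_subset hgK hs))
    · obtain ⟨e, heI, heK⟩ := Set.not_subset.1 hs
      have key : ∀ f ∈ K \ I, ∃ C ∈ S, C ⊆ insert e K \ {f} ∧ e ∈ C := by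
        rintro f ⟨hfK, hfI⟩
        have hfe : f ∈ insert e K := Or.inr hfK
        by_contra hno
        push Not at hno
        have hdep : ∀ C ∈ S, ¬ C ⊆ insert e K \ {f} := by
          intro C hC hCs
          have heC := hno C hC hCs
          refine hK C hC fun x hx => ?_
          rcases (hCs hx).1 with rfl | h'
          · exact absurd hx heC
          · exact h'
        refine ih ((I \ (insert e K \ {f})).ncard) ?_ (insert e K \ {f}) ?_ hdep ?_ rfl
        · rw [← hn]
          refine Set.ncard_lt_ncard ?_ (Set.toFinite _)
          refine ⟨fun x hx => ⟨hx.1, fun hxK => hx.2 ⟨Or.inr hxK, ?_⟩⟩, fun hsub => ?_⟩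
          · rintro rfl
            exact hfI hx.1
          · refine (hsub ⟨heI, heK⟩).2 ⟨Or.inl rfl, ?_⟩
            rintro rfl
            exact heK hfK
        · rintro x ⟨rfl | hx, -⟩
          · exact Or.inl heI
          · exact hKIJ hx
        · rw [Set.ncard_sdiff_singleton_of_mem hfe, Set.ncard_insert_of_notMem heK (Set.toFinite _)]
          simpa using hIK
      obtain ⟨Cg, hCg, hCgs, heg⟩ := key g ⟨hgK, hgI⟩
      obtain ⟨k, hkC, hkI⟩ := Set.not_subset.1 (hI Cg hCg)
      have hkK : k ∈ K := by
        rcases (hCgs hkC).1 with rfl | h'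
        · exact absurd heI hkI
        · exact h'
      obtain ⟨Ck, hCk, hCks, hek⟩ := key k ⟨hkK, hkI⟩
      have hne : Cg ≠ Ck := fun heq => (hCks (heq ▸ hkC)).2 rfl
      obtain ⟨C, hC, hCs⟩ := h Cg hCg Ck hCk hne e ⟨heg, hek⟩
      refine hK C hC fun x hx => ?_
      obtain ⟨hx1, hx2⟩ := hCs hx
      rcases hx1 with hx1 | hx1
      · exact (hCgs hx1).1.resolve_left hx2
      · exact (hCks hx1).1.resolve_left hx2

/-- The matroid on `E` whose independent sets are the sets containing no member of `S`, for a
family `S` of non-empty sets in which modular pairs satisfy circuit elimination. -/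
noncomputable def matroidOfCircuits {E : Type*} [Finite E] (S : Set (Set E)) (h₀ : ∅ ∉ S)
    (h : ∀ C₁ C₂, IsModularPair S C₁ C₂ → ∀ e ∈ C₁ ∩ C₂, ∃ C₃ ∈ S, C₃ ⊆ (C₁ ∪ C₂) \ {e}) :
    Matroid E :=
  (IndepMatroid.ofFinite (E := Set.univ) Set.finite_univ (fun I => ∀ C ∈ S, ¬ C ⊆ I)
    (fun _ hC hs => h₀ (Set.subset_empty_iff.1 hs ▸ hC))
    (fun _ _ hJ hIJ C hC hs => hJ C hC (hs.trans hIJ))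
    (fun _ _ hI hJ hlt => augmentation_of_elimination (elimination_of_modular h) hI hJ hlt)
    (fun _ _ => Set.subset_univ _)).matroid

/-! ### Weak matroids over a hyperfield -/

/-- The supports of the members of a set of vectors. -/
def supports {F E : Type*} [Hyperfield F] (𝒞 : Set (E → F)) : Set (Set E) :=
  Function.support '' 𝒞

/-- A weak `F`-matroid on `E`, given by its set of `F`-circuits. -/
@[ext]
structure WeakMatroid (F E : Type*) [Hyperfield F] where
  /-- The set of `F`-circuits. -/
  circuits : Set (E → F)
  /-- (C0) -/
  zero_notMem : (fun _ => 0) ∉ circuits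
  /-- (C1) -/
  smul_mem : ∀ X ∈ circuits, ∀ α : Fˣ, (fun e => (α : F) * X e) ∈ circuits
  /-- (C2): incomparability -/
  eq_smul_of_support_subset : ∀ X ∈ circuits, ∀ Y ∈ circuits,
    Function.support X ⊆ Function.support Y → ∃ α : Fˣ, X = fun e => (α : F) * Y e
  /-- (C3)': modular elimination -/
  modular_elimination : ∀ X ∈ circuits, ∀ Y ∈ circuits,
    IsModularPair (supports circuits) (Function.support X) (Function.support Y) →
    ∀ e, X e = -Y e → X e ≠ 0 →
      ∃ Z ∈ circuits, Z e = 0 ∧ ∀ f, Z f ∈ hadd (X f) (Y f)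

namespace WeakMatroid

variable {F E : Type*} [Hyperfield F]

theorem empty_notMem_supports (M : WeakMatroid F E) : ∅ ∉ supports M.circuits := by
  rintro ⟨X, hX, hs⟩
  rw [Function.support_eq_empty_iff] at hs
  subst hs
  exact M.zero_notMem hX

theorem supports_elimination (M : WeakMatroid F E) (C₁ C₂ : Set E)
    (hm : IsModularPair (supports M.circuits) C₁ C₂) (e : E) (he : e ∈ C₁ ∩ C₂) :
    ∃ C₃ ∈ supports M.circuits, C₃ ⊆ (C₁ ∪ C₂) \ {e} := by
  obtain ⟨X, hX, rfl⟩ := hm.1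
  obtain ⟨Y, hY, rfl⟩ := hm.2.1
  obtain ⟨heX, heY⟩ := he
  rw [Function.mem_support] at heX heY
  have hneg : -Y e ≠ 0 := by
    intro h0
    have := zero_mem_hadd_neg (Y e)
    rw [h0, hadd_comm, zero_hadd] at this
    exact heY this.symm
  set α : Fˣ := Units.mk0 (-Y e * (X e)⁻¹) (mul_ne_zero hneg (inv_ne_zero heX)) with hα
  have hsupp : Function.support (fun f => (α : F) * X f) = Function.support X := by
    ext f
    simp
  have hXe : (α : F) * X e = -Y e := by
    simp [hα, heX]
  obtain ⟨Z, hZ, hZe, hZf⟩ := M.modular_elimination _ (M.smul_mem X hX α) Y hY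
    (by rw [hsupp]; exact hm) e hXe (by rw [hXe]; exact hneg)
  refine ⟨_, ⟨Z, hZ, rfl⟩, fun f hf => ⟨?_, ?_⟩⟩
  · by_contra hno
    simp only [Set.mem_union, Function.mem_support, not_or, not_not] at hno
    have := hZf f
    simp only [hno.1, hno.2, mul_zero, zero_hadd, Set.mem_singleton_iff] at this
    exact hf this
  · rintro rfl
    exact hf hZe

/-- The underlying matroid of a weak `F`-matroid: a set is independent iff it contains no support
of an `F`-circuit. -/
noncomputable def underlying [Finite E] (M : WeakMatroid F E) : Matroid E :=
  matroidOfCircuits (supports M.circuits) M.empty_notMem_supports M.supports_elimination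

/-- Sanity check: the circuits of the underlying matroid are the supports of the `F`-circuits. -/
theorem isCircuit_underlying_iff [Finite E] (M : WeakMatroid F E) (C : Set E) :
    M.underlying.IsCircuit C ↔ C ∈ supports M.circuits := by
  have hind : ∀ I, M.underlying.Indep I ↔ ∀ C ∈ supports M.circuits, ¬ C ⊆ I := fun I => Iff.rfl
  have hdep : ∀ D, M.underlying.Dep D ↔ ∃ C ∈ supports M.circuits, C ⊆ D := by
    intro D
    rw [← Matroid.not_indep_iff (Set.subset_univ _), hind]
    push Not
    rfl
  constructor
  · intro hC
    obtain ⟨C', hC', hs⟩ := (hdep C).1 hC.dep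
    have hdC' : M.underlying.Dep C' := (hdep C').2 ⟨C', hC', subset_rfl⟩
    rwa [← hC.eq_of_dep_subset hdC' hs]
  · intro hC
    rw [Matroid.isCircuit_iff]
    refine ⟨(hdep C).2 ⟨C, hC, subset_rfl⟩, fun D hD hDC => ?_⟩
    obtain ⟨C', hC', hs⟩ := (hdep D).1 hD
    obtain ⟨X, hX, rfl⟩ := hC
    obtain ⟨Y, hY, rfl⟩ := hC'
    obtain ⟨α, rfl⟩ := M.eq_smul_of_support_subset Y hY X hX (hs.trans hDC)
    refine hDC.antisymm (subset_trans (fun f hf => ?_) hs)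
    simpa using hf

/-- The rank of a weak `F`-matroid is the rank of its underlying matroid. -/
noncomputable def rank [Finite E] (M : WeakMatroid F E) : ℕ∞ :=
  M.underlying.eRank

end WeakMatroid

/-! ### Weak Grassmann–Plücker functions -/

/-- The tuple `(a, y₁, …, y_{r-1})`. -/
def prepend {E : Type*} {r : ℕ} (a : E) (y : Fin (r - 1) → E) : Fin r → E :=
  fun i => if h : (i : ℕ) = 0 then a else y ⟨(i : ℕ) - 1, by omega⟩

/-- A weak Grassmann–Plücker function of rank `r` on `E` with coefficients in `F`. -/
@[ext]
structure WeakGP (F E : Type*) [Hyperfield F] (r : ℕ) where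
  /-- The function `φ : E ^ r → F`. -/
  toFun : (Fin r → E) → F
  /-- (GP1) -/
  exists_ne_zero : ∃ x, toFun x ≠ 0
  /-- (GP2), antisymmetry -/
  map_swap : ∀ (x : Fin r → E) (i j : Fin r), i ≠ j → toFun (x ∘ Equiv.swap i j) = -toFun x
  /-- (GP2), vanishing on tuples with a repeated entry -/
  map_eq_zero : ∀ (x : Fin r → E) (i j : Fin r), i ≠ j → x i = x j → toFun x = 0
  /-- The support of `φ` is the set of bases of a matroid of rank `r` on `E`. -/
  exists_matroid : ∃ M : Matroid E, M.E = Set.univ ∧ M.eRank = r ∧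
    ∀ B, M.IsBase B ↔ ∃ x : Fin r → E, toFun x ≠ 0 ∧ Set.range x = B
  /-- (GP3)', the 3-term Grassmann–Plücker relations, for subsets `I = {x₁, …, x_{r+1}}` and
  `J = {y₁, …, y_{r-1}}` with `|I \ J| = 3`; the index `k` starts at `0` here and at `1` in
  the usual notation. -/
  three_term : ∀ (x : Fin (r + 1) → E) (y : Fin (r - 1) → E),
    Function.Injective x → Function.Injective y →
    (Set.range x \ Set.range y).ncard = 3 →
    (0 : F) ∈ hsum (List.ofFn fun k : Fin (r + 1) =>
      (-1) ^ ((k : ℕ) + 1) * toFun (x ∘ k.succAbove) * toFun (prepend (x k) y))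

namespace WeakGP

variable {F E : Type*} [Hyperfield F] {r : ℕ}

/-- The underlying matroid of `φ`; its bases are the members of the support of `φ`. -/
noncomputable def underlying (φ : WeakGP F E r) : Matroid E := φ.exists_matroid.choose

theorem underlying_ground (φ : WeakGP F E r) : φ.underlying.E = Set.univ :=
  φ.exists_matroid.choose_spec.1

theorem underlying_isBase_iff (φ : WeakGP F E r) (B : Set E) :
    φ.underlying.IsBase B ↔ ∃ x : Fin r → E, φ.toFun x ≠ 0 ∧ Set.range x = B :=
  φ.exists_matroid.choose_spec.2.2 B

/-- The set `𝒞_φ` of all `X ∈ F ^ E` whose support is a circuit of the underlying matroid of `φ`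
and such that `X(f) / X(e) = - φ(e, x₂, …, x_r) / φ(f, x₂, …, x_r)` for all `e, f` and all bases
`{f, x₂, …, x_r}` containing `supp X \ {e}`. -/
def circuits (φ : WeakGP F E r) : Set (E → F) :=
  {X | φ.underlying.IsCircuit (Function.support X) ∧
    ∀ (e f : E) (y : Fin (r - 1) → E), φ.underlying.IsBase (Set.range (prepend (r := r) f y)) →
      Function.support X \ {e} ⊆ Set.range (prepend (r := r) f y) →
      X f / X e = -(φ.toFun (prepend e y) / φ.toFun (prepend f y))}

/-- Two weak Grassmann–Plücker functions are equivalent if they differ by a nonzero scalar. -/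
instance setoid (F E : Type*) [Hyperfield F] (r : ℕ) : Setoid (WeakGP F E r) where
  r φ₁ φ₂ := ∃ α : Fˣ, φ₁.toFun = fun x => (α : F) * φ₂.toFun x
  iseqv :=
    { refl := fun φ => ⟨1, by simp⟩
      symm := by
        rintro φ₁ φ₂ ⟨α, h⟩
        exact ⟨α⁻¹, by funext x; simp [h]⟩
      trans := by
        rintro φ₁ φ₂ φ₃ ⟨α, h⟩ ⟨β, h'⟩
        exact ⟨α * β, by funext x; simp [h, h', mul_assoc]⟩ }

end WeakGP

/-- Equivalence classes of weak Grassmann–Plücker functions of rank `r` on `E` over `F`. -/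
abbrev WeakGPClass (F E : Type*) [Hyperfield F] (r : ℕ) : Type _ :=
  Quotient (WeakGP.setoid F E r)

end HyperfieldMatroid

/-! Write x[i → e] for `update x i e`. Both directions rest on one division-free condition,
`IsTwoTermOrthogonal`: X(e) φ(x[i → e]) = -X(x i) φ(x) whenever supp X lies in range x together with
e. For vectors supported on circuits it is equivalent to membership in 𝒞_φ
(`WeakGP.mem_circuits_iff`). The 3-term relations are used in the form `IsPlucker`, which compares a
tuple with those obtained by replacing two of its entries.

From φ to circuits: a fundamental circuit of a base carries a vector with the prescribed exchange
ratios. Moving to another base, one term of the Plücker relation vanishes, so the relation becomes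
an equality and the ratios persist (`fundamental_ratio`, `exists_isTwoTermOrthogonal`). For modular
elimination, the new circuit carries an orthogonal vector, scaled to agree with X at a point of supp
X \ supp Y; a Plücker relation then says exactly that its other coordinates lie in X ⊞ Y.

From circuits to φ: the function is built on the ordered bases inside a set S, which grows from one
base to all of E. When e is added, the value at a base through e is forced by exchanging e for an
element of S along a circuit. Two choices agree because eliminating e between the two circuits gives
a circuit inside S (`IsExtensionWitness.mul_eq_mul`). Modular elimination applies since the circuits
involved lie in a base plus two elements (`isModularPair_of_subset_insert_insert`). The Plücker
relations then come from eliminating a common element of two fundamental circuits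
(`mem_hadd_of_ne_zero`), degenerate cases being two-term identities.

Injectivity: 𝒞_φ fixes the ratio of φ at any two bases related by an exchange, and exchanges connect
all bases (`isBase_tuple_induction`). -/

namespace HyperfieldMatroid

open Hyperfield Function Matrix

/-! ### Hyperfield arithmetic and signs of permutations. -/

section Algebra

variable {F : Type*} [Hyperfield F]

/-- Multiplying 0 ∈ 1 ⊞ (-1) by x gives 0 ∈ x ⊞ x(-1), and hyperinverses are unique. All sign rules
follow from this. -/
theorem hyperfield_mul_neg_one (x : F) : x * -1 = -x := by
  apply eq_neg_of_zero_mem_hadd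
  have h := mul_hadd x 1 (-1 : F)
  rw [mul_one] at h
  rw [← h]
  exact ⟨0, zero_mem_hadd_neg 1, mul_zero x⟩

instance : HasDistribNeg F where
  neg := Neg.neg
  neg_neg x := by
    symm
    apply eq_neg_of_zero_mem_hadd
    rw [hadd_comm]
    exact zero_mem_hadd_neg x
  neg_mul x y := by
    rw [← hyperfield_mul_neg_one x, ← hyperfield_mul_neg_one (x * y), mul_right_comm]
  mul_neg x y := by
    rw [← hyperfield_mul_neg_one y, ← hyperfield_mul_neg_one (x * y), mul_assoc]

theorem hyperfield_neg_eq_zero {x : F} : -x = 0 ↔ x = 0 := by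
  constructor
  · intro h
    rw [← neg_neg x, h, neg_zero]
  · rintro rfl
    exact neg_zero

theorem zero_mem_hadd_iff {x y : F} : (0 : F) ∈ hadd x y ↔ y = -x :=
  ⟨eq_neg_of_zero_mem_hadd x y, fun h => h ▸ zero_mem_hadd_neg x⟩

theorem hadd_zero (x : F) : hadd x 0 = {x} := by
  rw [hadd_comm, zero_hadd]

theorem mul_mem_hadd {a x y z : F} (h : z ∈ hadd x y) : a * z ∈ hadd (a * x) (a * y) := by
  rw [← mul_hadd]
  exact ⟨z, h, rfl⟩

theorem mul_mem_hadd_iff {a x y z : F} (ha : a ≠ 0) :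
    a * z ∈ hadd (a * x) (a * y) ↔ z ∈ hadd x y := by
  refine ⟨fun h => ?_, mul_mem_hadd⟩
  simpa [inv_mul_cancel_left₀ ha] using mul_mem_hadd (a := a⁻¹) h

/-- Associativity and commutativity exchange adjacent terms. This lets the three relevant terms of a
Grassmann–Plücker relation be moved to the front. -/
theorem hsum_perm {l l' : List F} (h : l.Perm l') : hsum l = hsum l' := by
  induction h with
  | nil => rfl
  | cons x _ ih => simp only [hsum, ih]
  | swap x y l =>
    ext t
    simp only [hsum, Set.mem_iUnion, exists_prop]
    constructor
    · rintro ⟨u, ⟨v, hv, hu⟩, ht⟩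
      have : t ∈ ⋃ w ∈ hadd x v, hadd y w := by
        simp only [Set.mem_iUnion, exists_prop]
        exact ⟨u, hu, ht⟩
      rw [hadd_assoc, hadd_comm y x, ← hadd_assoc] at this
      simp only [Set.mem_iUnion, exists_prop] at this
      obtain ⟨w, hw, ht⟩ := this
      exact ⟨w, ⟨v, hv, hw⟩, ht⟩
    · rintro ⟨u, ⟨v, hv, hu⟩, ht⟩
      have : t ∈ ⋃ w ∈ hadd y v, hadd x w := by
        simp only [Set.mem_iUnion, exists_prop]
        exact ⟨u, hu, ht⟩
      rw [hadd_assoc, hadd_comm x y, ← hadd_assoc] at this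
      simp only [Set.mem_iUnion, exists_prop] at this
      obtain ⟨w, hw, ht⟩ := this
      exact ⟨w, ⟨v, hv, hw⟩, ht⟩
  | trans _ _ ih₁ ih₂ => exact ih₁.trans ih₂

theorem hsum_of_forall_eq_zero {l : List F} (h : ∀ t ∈ l, t = 0) : hsum l = {0} := by
  induction l with
  | nil => rfl
  | cons a l ih =>
    obtain rfl := h a List.mem_cons_self
    simp [hsum, ih fun t ht => h t (List.mem_cons_of_mem _ ht), zero_hadd]

theorem zero_mem_hsum_cons_cons_cons {a b c : F} {l : List F} (h : ∀ t ∈ l, t = 0) :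
    (0 : F) ∈ hsum (a :: b :: c :: l) ↔ -a ∈ hadd b c := by
  simp only [hsum, hsum_of_forall_eq_zero h, Set.mem_singleton_iff, Set.iUnion_iUnion_eq_left,
    hadd_zero, Set.mem_iUnion, exists_prop, zero_mem_hadd_iff]
  simp

/-- The image in `F` of the sign of a permutation. -/
def signIn (F : Type*) [Hyperfield F] {ι : Type*} [Fintype ι] [DecidableEq ι]
    (σ : Equiv.Perm ι) : F :=
  if Equiv.Perm.sign σ = 1 then 1 else -1

variable {ι : Type*} [Fintype ι] [DecidableEq ι]

theorem signIn_one : signIn F (1 : Equiv.Perm ι) = 1 := by simp [signIn]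

theorem signIn_mul (σ τ : Equiv.Perm ι) : signIn F (σ * τ) = signIn F σ * signIn F τ := by
  unfold signIn
  rcases Int.units_eq_one_or (Equiv.Perm.sign σ) with h | h <;>
  rcases Int.units_eq_one_or (Equiv.Perm.sign τ) with h' | h' <;>
  simp [h, h']

theorem signIn_swap {i j : ι} (h : i ≠ j) : signIn F (Equiv.swap i j) = -1 := by
  simp [signIn, Equiv.Perm.sign_swap h]

theorem signIn_mul_self (σ : Equiv.Perm ι) : signIn F σ * signIn F σ = 1 := by
  unfold signIn
  split_ifs <;> simp

theorem signIn_ne_zero (σ : Equiv.Perm ι) : signIn F σ ≠ 0 :=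
  left_ne_zero_of_mul_eq_one (signIn_mul_self σ)

theorem signIn_eq_neg_one_pow {σ : Equiv.Perm ι} {k : ℕ}
    (h : Equiv.Perm.sign σ = (-1) ^ k) : signIn F σ = (-1) ^ k := by
  unfold signIn
  rw [h]
  rcases Nat.even_or_odd k with hk | hk
  · simp [hk.neg_one_pow]
  · simp [hk.neg_one_pow]

end Algebra

/-! ### Antisymmetric functions of tuples. -/

section Alternating

variable {F E : Type*} [Hyperfield F]

/-- Exchanging two arguments replaces the value by its hyperinverse. -/
def IsAntisymm {ι : Type*} [DecidableEq ι] (φ : (ι → E) → F) : Prop :=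
  ∀ (x : ι → E) (i j : ι), i ≠ j → φ (x ∘ Equiv.swap i j) = -φ x

theorem IsAntisymm.map_perm {ι : Type*} [Fintype ι] [DecidableEq ι] {φ : (ι → E) → F}
    (h : IsAntisymm φ) (x : ι → E) (σ : Equiv.Perm ι) : φ (x ∘ σ) = signIn F σ * φ x := by
  induction σ using Equiv.Perm.swap_induction_on generalizing x with
  | one => simp [signIn_one]
  | swap_mul f i j hij ih =>
    rw [Equiv.Perm.coe_mul, ← Function.comp_assoc, ih, h x i j hij, signIn_mul, signIn_swap hij]
    simp

theorem IsAntisymm.map_cons_comp {m : ℕ} {φ : (Fin (m + 1) → E) → F} (h : IsAntisymm φ)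
    (a : E) (y : Fin m → E) (ρ : Equiv.Perm (Fin m)) :
    φ (vecCons a (y ∘ ρ)) = signIn F ρ * φ (vecCons a y) := by
  have h1 : vecCons a (y ∘ ρ) = vecCons a y ∘ Equiv.Perm.decomposeFin.symm (0, ρ) := by
    funext k
    refine Fin.cases ?_ (fun k => ?_) k <;> simp
  rw [h1, h.map_perm]
  congr 1
  simp [signIn]

/-- The terms of the Grassmann–Plücker relations, up to a sign, for an arbitrary arrangement
in which the omitted element comes first. -/
theorem IsAntisymm.neg_one_pow_mul_succAbove {m : ℕ} {φ : (Fin m → E) → F} (h : IsAntisymm φ)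
    (x : Fin (m + 1) → E) (τ : Equiv.Perm (Fin (m + 1))) :
    (-1) ^ ((τ 0 : ℕ) + 1) * φ (x ∘ (τ 0).succAbove) = -(signIn F τ * φ (x ∘ τ ∘ Fin.succ)) := by
  -- `(τ 0).cycleRange` sends τ 0 to 0, so its product with τ fixes 0 and comes from a permutation ρ
  -- of the remaining positions. The cycle itself has sign (-1)^(τ 0).
  obtain ⟨⟨p, ρ⟩, hρ⟩ :=
    Equiv.Perm.decomposeFin.symm.surjective ((τ 0).cycleRange * τ)
  have hp : p = 0 := by
    have := congrArg (fun f : Equiv.Perm (Fin (m + 1)) => f 0) hρ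
    simpa using this
  subst hp
  have hτ : τ = (τ 0).cycleRange⁻¹ * Equiv.Perm.decomposeFin.symm (0, ρ) := by
    rw [hρ]; group
  have h1 : x ∘ τ ∘ Fin.succ = (x ∘ (τ 0).succAbove) ∘ ρ := by
    funext k
    have h2 := congrArg (fun f : Equiv.Perm (Fin (m + 1)) => f k.succ) hτ
    simp only [Equiv.Perm.coe_mul, Function.comp_apply,
      Equiv.Perm.decomposeFin_symm_apply_succ, Equiv.swap_self, Equiv.refl_apply] at h2
    simp only [Function.comp_apply]
    rw [h2]
    congr 1
    exact Fin.cycleRange_symm_succ _ _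
  have h3 : signIn F τ = (-1) ^ (τ 0 : ℕ) * signIn F ρ := by
    conv_lhs => rw [hτ]
    rw [signIn_mul]
    congr 1
    · apply signIn_eq_neg_one_pow
      rw [Equiv.Perm.sign_inv, Fin.sign_cycleRange]
    · simp [signIn]
  rw [h1, h.map_perm, h3, pow_succ]
  have : signIn F ρ * (signIn F ρ * φ (x ∘ (τ 0).succAbove)) = φ (x ∘ (τ 0).succAbove) := by
    rw [← mul_assoc, signIn_mul_self, one_mul]
  rw [mul_assoc _ (signIn F ρ), this]
  simp

theorem range_comp_perm {ι α : Type*} (x : ι → α) (σ : Equiv.Perm ι) :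
    Set.range (x ∘ σ) = Set.range x := EquivLike.range_comp x σ

theorem exists_perm_of_range_eq {ι α : Type*} {x y : ι → α} (hx : Injective x) (hy : Injective y)
    (h : Set.range x = Set.range y) : ∃ σ : Equiv.Perm ι, y = x ∘ σ := by
  refine ⟨(Equiv.ofInjective y hy).trans ((Equiv.setCongr h.symm).trans
    (Equiv.ofInjective x hx).symm), ?_⟩
  funext i
  simp only [Function.comp_apply, Equiv.trans_apply]
  exact (Equiv.apply_ofInjective_symm hx ⟨y i, h ▸ Set.mem_range_self i⟩).symm

end Alternating

/-! ### The 3-term Grassmann–Plücker relations as exchange relations. -/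

section Plucker

variable {F E : Type*} [Hyperfield F]

theorem prepend_succ {E : Type*} {m : ℕ} (a : E) (y : Fin m → E) :
    prepend (r := m + 1) a y = vecCons a y := by
  funext k
  refine Fin.cases ?_ (fun k => ?_) k
  · simp [prepend]
  · simp [prepend]

theorem update_vecCons_zero {m : ℕ} (a b : E) (y : Fin m → E) :
    update (vecCons a y) 0 b = vecCons b y := by
  funext k
  refine Fin.cases ?_ (fun k => ?_) k <;> simp

theorem update_vecCons_one {m : ℕ} (a b c : E) (y : Fin m → E) :
    update (vecCons a (vecCons b y)) 1 c = vecCons a (vecCons c y) := by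
  funext k
  refine Fin.cases ?_ (fun k => ?_) k
  · simp
  · refine Fin.cases ?_ (fun k => ?_) k
    · simp
    · rw [update_of_ne (by simp [Fin.ext_iff])]
      simp

theorem vecCons_comp_swap {m : ℕ} (a b : E) (y : Fin m → E) :
    vecCons a (vecCons b y) ∘ Equiv.swap 0 1 = vecCons b (vecCons a y) := by
  funext k
  refine Fin.cases ?_ (fun k => ?_) k
  · simp
  · refine Fin.cases ?_ (fun k => ?_) k
    · simp
    · simp only [Function.comp_apply]
      rw [Equiv.swap_apply_of_ne_of_ne (by simp [Fin.ext_iff]) (by simp [Fin.ext_iff])]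
      simp

theorem IsAntisymm.map_vecCons_swap {m : ℕ} {φ : (Fin (m + 2) → E) → F} (h : IsAntisymm φ)
    (a b : E) (y : Fin m → E) :
    φ (vecCons b (vecCons a y)) = -φ (vecCons a (vecCons b y)) := by
  rw [← h _ 0 1 (by simp), vecCons_comp_swap]

/-- The `3`-term Grassmann–Plücker relations, in terms of a tuple in which two
entries are replaced. -/
def IsPlucker {ι : Type*} [DecidableEq ι] (φ : (ι → E) → F) : Prop :=
  ∀ (x : ι → E) (i j : ι) (c d : E), Injective x → i ≠ j → c ≠ d →
    c ∉ Set.range x → d ∉ Set.range x →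
    φ x * φ (update (update x i c) j d) ∈
      hadd (φ (update x i c) * φ (update x j d)) (-(φ (update x i d) * φ (update x j c)))

theorem vecCons_injective_iff {m : ℕ} {a : E} {y : Fin m → E} :
    Injective (vecCons a y) ↔ a ∉ Set.range y ∧ Injective y :=
  Fin.cons_injective_iff

theorem range_vecCons {m : ℕ} (a : E) (y : Fin m → E) :
    Set.range (vecCons a y) = insert a (Set.range y) :=
  Fin.range_cons a y

/-- A Grassmann–Plücker relation with only three terms that do not vanish for trivial
reasons. -/
theorem zero_mem_hsum_ofFn_iff {m : ℕ} {φ : (Fin (m + 2) → E) → F} (h : IsAntisymm φ)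
    (h0 : ∀ x i j, i ≠ j → x i = x j → φ x = 0) (x : Fin (m + 3) → E) (y : Fin (m + 1) → E)
    (π : Equiv.Perm (Fin (m + 3))) (ρ : Equiv.Perm (Fin (m + 1))) (a b c d : E) (z : Fin m → E)
    (hx : x ∘ π = vecCons a (vecCons b (vecCons c z))) (hy : y ∘ ρ = vecCons d z) :
    (0 : F) ∈ hsum (List.ofFn fun k : Fin (m + 3) =>
      (-1) ^ ((k : ℕ) + 1) * φ (x ∘ k.succAbove) * φ (vecCons (x k) y)) ↔
    φ (vecCons b (vecCons c z)) * φ (vecCons a (vecCons d z)) ∈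
      hadd (φ (vecCons a (vecCons c z)) * φ (vecCons b (vecCons d z)))
        (-(φ (vecCons a (vecCons b z)) * φ (vecCons c (vecCons d z)))) := by
  set t : Fin (m + 3) → F := fun k =>
    (-1) ^ ((k : ℕ) + 1) * φ (x ∘ k.succAbove) * φ (vecCons (x k) y) with ht
  have hyφ : ∀ u, φ (vecCons u y) = signIn F ρ * φ (vecCons u (vecCons d z)) := by
    intro u
    rw [← hy, h.map_cons_comp, ← mul_assoc, signIn_mul_self, one_mul]
  have key : ∀ τ : Equiv.Perm (Fin (m + 3)), t (τ 0) =
      -(signIn F τ * φ (x ∘ τ ∘ Fin.succ) *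
        (signIn F ρ * φ (vecCons (x (τ 0)) (vecCons d z)))) := by
    intro τ
    simp only [ht]
    rw [h.neg_one_pow_mul_succAbove, hyφ, neg_mul]
  have hxk : ∀ k, x (π k) = vecCons a (vecCons b (vecCons c z)) k := fun k => congrFun hx k
  have e0 : x ∘ π ∘ Fin.succ = vecCons b (vecCons c z) := by
    rw [← Function.comp_assoc, hx]
    rfl
  have e1 : x ∘ (π * Equiv.swap 0 1 : Equiv.Perm _) ∘ Fin.succ = vecCons a (vecCons c z) := by
    rw [Equiv.Perm.coe_mul, ← Function.comp_assoc, ← Function.comp_assoc, hx, vecCons_comp_swap]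
    rfl
  have h02 : (2 : Fin (m + 3)) = Fin.succ (Fin.succ 0) := rfl
  have hne : ∀ k : Fin (m + 3), (k : ℕ) ≠ 2 → k ≠ 2 := fun k hk h => hk (by rw [h]; rfl)
  -- Bringing c to the front leaves a after b. Restoring the order a, b costs one more sign, which
  -- is why the third term is subtracted.
  have e2 : x ∘ (π * (Equiv.swap 0 2) : Equiv.Perm _) ∘ Fin.succ =
      vecCons b (vecCons a z) := by
    rw [Equiv.Perm.coe_mul, ← Function.comp_assoc, ← Function.comp_assoc, hx]
    funext k
    refine Fin.cases ?_ (fun k => Fin.cases ?_ (fun k => ?_) k) k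
    · simp only [Function.comp_apply]
      rw [Equiv.swap_apply_of_ne_of_ne (by simp) (hne _ (by simp))]
      rfl
    · simp only [Function.comp_apply]
      rw [← h02, Equiv.swap_apply_right]
      rfl
    · simp only [Function.comp_apply]
      rw [Equiv.swap_apply_of_ne_of_ne (by simp) (hne _ (by simp))]
      rfl
  set s : F := signIn F π * signIn F ρ with hs
  have hs0 : s ≠ 0 := mul_ne_zero (signIn_ne_zero _) (signIn_ne_zero _)
  have t0 : t (π 0) = -(s * (φ (vecCons b (vecCons c z)) * φ (vecCons a (vecCons d z)))) := by
    rw [key, e0, hxk, hs, mul_mul_mul_comm]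
    rfl
  have t1 : t (π 1) = s * (φ (vecCons a (vecCons c z)) * φ (vecCons b (vecCons d z))) := by
    have := key (π * Equiv.swap 0 1)
    rw [e1, signIn_mul, signIn_swap (by simp)] at this
    simp only [Equiv.Perm.coe_mul, Function.comp_apply, Equiv.swap_apply_left] at this
    rw [this, hxk, hs, ← mul_mul_mul_comm]
    simp
  have t2 : t (π 2) = s * (-(φ (vecCons a (vecCons b z)) * φ (vecCons c (vecCons d z)))) := by
    have := key (π * Equiv.swap 0 2)
    rw [e2, signIn_mul, signIn_swap (hne 0 (by simp)), h.map_vecCons_swap] at this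
    simp only [Equiv.Perm.coe_mul, Function.comp_apply, Equiv.swap_apply_left] at this
    rw [this, hxk, hs, ← neg_mul (φ _), ← mul_mul_mul_comm]
    simp
  -- An entry of z already occurs among the y's, so the second factor has a repeated argument.
  have t3 : ∀ k : Fin m, t (π k.succ.succ.succ) = 0 := by
    intro k
    have : φ (vecCons (z k) (vecCons d z)) = 0 :=
      h0 _ 0 k.succ.succ (Fin.succ_ne_zero _).symm (by simp)
    simp only [ht, hyφ, hxk]
    simp [this]
  rw [hsum_perm (Equiv.Perm.ofFn_comp_perm π t).symm]
  simp only [List.ofFn_succ]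
  rw [zero_mem_hsum_cons_cons_cons]
  · have h1 : (Fin.succ 0 : Fin (m + 3)) = 1 := rfl
    have h2 : (Fin.succ (Fin.succ 0) : Fin (m + 3)) = 2 := rfl
    simp only [Function.comp_apply, h1, h2]
    rw [t0, t1, t2, neg_neg, mul_mem_hadd_iff hs0]
  · intro u hu
    rw [List.mem_ofFn] at hu
    obtain ⟨k, rfl⟩ := hu
    exact t3 k

theorem exists_perm_zero_one {m : ℕ} {i j : Fin (m + 2)} (hij : i ≠ j) :
    ∃ π : Equiv.Perm (Fin (m + 2)), π 0 = i ∧ π 1 = j := by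
  refine ⟨Equiv.swap 0 i * Equiv.swap 1 (Equiv.swap 0 i j), ?_, ?_⟩
  · have : Equiv.swap 0 i j ≠ 0 := by
      intro h
      rw [Equiv.swap_apply_eq_iff, Equiv.swap_apply_left] at h
      exact hij h.symm
    rw [Equiv.Perm.mul_apply, Equiv.swap_apply_of_ne_of_ne (by simp) this.symm]
    simp
  · simp

theorem update_comp_perm {ι : Type*} [DecidableEq ι] (x : ι → E) (π : Equiv.Perm ι) (i : ι)
    (c : E) : update x (π i) c ∘ π = update (x ∘ π) i c := by
  funext k
  simp [update_apply]

theorem exists_eq_vecCons {m : ℕ} (x : Fin (m + 1) → E) : ∃ a y, x = vecCons a y :=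
  ⟨x 0, fun k => x k.succ, by funext k; refine Fin.cases ?_ (fun k => ?_) k <;> simp⟩

theorem IsAntisymm.map_mul_map_comp_perm {ι : Type*} [Fintype ι] [DecidableEq ι]
    {φ : (ι → E) → F} (h : IsAntisymm φ) (x y : ι → E) (π : Equiv.Perm ι) :
    φ (x ∘ π) * φ (y ∘ π) = φ x * φ y := by
  rw [h.map_perm, h.map_perm, mul_mul_mul_comm, signIn_mul_self, one_mul]

/-- Every term is a product of two values of φ, so permuting all tuples at once introduces a sign
twice and changes nothing. Hence the replaced positions may be taken to be 0 and 1. -/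
theorem IsAntisymm.isPlucker_iff {m : ℕ} {φ : (Fin (m + 2) → E) → F} (h : IsAntisymm φ) :
    IsPlucker φ ↔ ∀ (a b c d : E) (z : Fin m → E),
      Injective (vecCons d (vecCons a (vecCons b (vecCons c z)))) →
      φ (vecCons b (vecCons c z)) * φ (vecCons a (vecCons d z)) ∈
      hadd (φ (vecCons a (vecCons c z)) * φ (vecCons b (vecCons d z)))
        (-(φ (vecCons a (vecCons b z)) * φ (vecCons c (vecCons d z)))) := by
  constructor
  · intro hp a b c d z hinj
    rw [vecCons_injective_iff, vecCons_injective_iff] at hinj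
    obtain ⟨hd, ha, hinj⟩ := hinj
    simp only [range_vecCons, Set.mem_insert_iff, not_or] at ha hd
    have := hp (vecCons b (vecCons c z)) 0 1 a d hinj (by simp) (Ne.symm hd.1)
      (by simpa only [range_vecCons, Set.mem_insert_iff, not_or] using ha)
      (by simpa only [range_vecCons, Set.mem_insert_iff, not_or] using hd.2)
    simp only [update_vecCons_zero, update_vecCons_one] at this
    rw [h.map_vecCons_swap c d, h.map_vecCons_swap a b, neg_mul_neg, mul_comm (φ (vecCons c _))]
      at this
    exact this
  · intro hp x i j c d hx hij hcd hc hd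
    obtain ⟨π, rfl, rfl⟩ := exists_perm_zero_one hij
    rw [← h.map_mul_map_comp_perm x _ π, ← h.map_mul_map_comp_perm (update x (π 0) c) _ π,
      ← h.map_mul_map_comp_perm (update x (π 0) d) _ π]
    simp only [update_comp_perm]
    have hx' : Injective (x ∘ π) := hx.comp π.injective
    rw [← range_comp_perm x π] at hc hd
    generalize x ∘ π = x' at *
    obtain ⟨a, x', rfl⟩ := exists_eq_vecCons x'
    obtain ⟨b, z, rfl⟩ := exists_eq_vecCons x'
    have := hp c a b d z (by
      rw [vecCons_injective_iff, vecCons_injective_iff, range_vecCons, Set.mem_insert_iff, not_or]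
      exact ⟨⟨hcd.symm, hd⟩, hc, hx'⟩)
    simp only [update_vecCons_zero, update_vecCons_one]
    rw [h.map_vecCons_swap b d, neg_mul, ← mul_neg, ← h.map_vecCons_swap, mul_comm (φ (vecCons b _))]
    exact this

/-- Counting shows that |I \ J| = 3 forces |J \ I| = 1. So I = {a, b, c} ∪ Z and J = {d} ∪ Z with
|Z| = r - 2. For r ≤ 1 both sides are vacuous. -/
theorem IsAntisymm.isPlucker_iff_zero_mem_hsum {r : ℕ} {φ : (Fin r → E) → F}
    (h : IsAntisymm φ) (h0 : ∀ x i j, i ≠ j → x i = x j → φ x = 0) :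
    IsPlucker φ ↔ ∀ (x : Fin (r + 1) → E) (y : Fin (r - 1) → E),
      Injective x → Injective y → (Set.range x \ Set.range y).ncard = 3 →
      (0 : F) ∈ hsum (List.ofFn fun k : Fin (r + 1) =>
        (-1) ^ ((k : ℕ) + 1) * φ (x ∘ k.succAbove) * φ (prepend (x k) y)) := by
  match r, φ, h, h0 with
  | 0, φ, h, h0 =>
    refine ⟨fun _ x y _ _ hc => ?_, fun _ x i => i.elim0⟩
    have h1 := Set.ncard_le_ncard (Set.sdiff_subset (s := Set.range x) (t := Set.range y))
      (Set.finite_range x)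
    have h2 : (Set.range x).ncard ≤ 1 := by
      rw [← Set.image_univ]
      exact (Set.ncard_image_le Set.finite_univ).trans (by simp [Set.ncard_univ])
    omega
  | 1, φ, h, h0 =>
    refine ⟨fun _ x y _ _ hc => ?_, fun _ x i j _ _ _ hij => (hij (Subsingleton.elim _ _)).elim⟩
    have h1 := Set.ncard_le_ncard (Set.sdiff_subset (s := Set.range x) (t := Set.range y))
      (Set.finite_range x)
    have h2 : (Set.range x).ncard ≤ 2 := by
      rw [← Set.image_univ]
      exact (Set.ncard_image_le Set.finite_univ).trans (by simp [Set.ncard_univ])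
    omega
  | m + 2, φ, h, h0 =>
    rw [h.isPlucker_iff]
    constructor
    · intro hp x y hx hy hc
      change Fin (m + 1) → E at y
      have hcx : (Set.range x).ncard = m + 3 := by
        rw [← Set.image_univ, Set.ncard_image_of_injective _ hx]
        simp [Set.ncard_univ]
      have hcy : (Set.range y).ncard = m + 1 := by
        rw [← Set.image_univ, Set.ncard_image_of_injective _ hy]
        simp [Set.ncard_univ]
      have hci : (Set.range x ∩ Set.range y).ncard = m := by
        have := Set.ncard_inter_add_ncard_sdiff_eq_ncard (Set.range x) (Set.range y)
          (Set.finite_range x)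
        omega
      have hcd : (Set.range y \ Set.range x).ncard = 1 := by
        have := Set.ncard_inter_add_ncard_sdiff_eq_ncard (Set.range y) (Set.range x)
          (Set.finite_range y)
        rw [Set.inter_comm] at this
        omega
      obtain ⟨a, b, c, hab, hac, hbc, habc⟩ := Set.ncard_eq_three.1 hc
      obtain ⟨d, hd⟩ := Set.ncard_eq_one.1 hcd
      obtain ⟨z, hz, hzr⟩ : ∃ z : Fin m → E, Injective z ∧
          Set.range z = Set.range x ∩ Set.range y := by
        have hfin : (Set.range x ∩ Set.range y).Finite := (Set.finite_range x).inter_of_left _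
        have hn : Nat.card ↥(Set.range x ∩ Set.range y) = m := hci
        have := hfin.to_subtype
        refine ⟨fun k => ((Finite.equivFinOfCardEq hn).symm k : E), fun k l hkl => by
          simpa using Subtype.ext hkl, ?_⟩
        ext t
        constructor
        · rintro ⟨k, rfl⟩
          exact Subtype.mem _
        · intro ht
          exact ⟨Finite.equivFinOfCardEq hn ⟨t, ht⟩, by simp⟩
      have hma : ∀ t, t ∈ ({a, b, c} : Set E) ↔ t ∈ Set.range x ∧ t ∉ Set.range y := fun t => by
        rw [← habc]; rfl
      have hmd : ∀ t, t = d ↔ t ∈ Set.range y ∧ t ∉ Set.range x := fun t => by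
        rw [← Set.mem_singleton_iff, ← hd]; rfl
      have hmz : ∀ t, t ∈ Set.range z ↔ t ∈ Set.range x ∧ t ∈ Set.range y := fun t => by
        rw [hzr]; rfl
      have ha := (hma a).1 (by simp)
      have hb := (hma b).1 (by simp)
      have hc' := (hma c).1 (by simp)
      have hd' := (hmd d).1 rfl
      have hi1 : Injective (vecCons a (vecCons b (vecCons c z))) := by
        simp only [vecCons_injective_iff, range_vecCons, Set.mem_insert_iff, not_or, hmz]
        exact ⟨⟨hab, hac, fun h => ha.2 h.2⟩, ⟨hbc, fun h => hb.2 h.2⟩, fun h => hc'.2 h.2, hz⟩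
      have hr1 : Set.range x = Set.range (vecCons a (vecCons b (vecCons c z))) := by
        ext t
        simp only [range_vecCons, Set.mem_insert_iff, hmz]
        have := hma t
        simp only [Set.mem_insert_iff, Set.mem_singleton_iff] at this
        tauto
      have hr2 : Set.range y = Set.range (vecCons d z) := by
        ext t
        simp only [range_vecCons, Set.mem_insert_iff, hmz]
        have := hmd t
        tauto
      have hi2 : Injective (vecCons d z) := by
        rw [vecCons_injective_iff, hmz]
        exact ⟨fun h => hd'.2 h.1, hz⟩
      obtain ⟨π, hπ⟩ := exists_perm_of_range_eq hx hi1 hr1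
      obtain ⟨ρ, hρ⟩ := exists_perm_of_range_eq hy hi2 hr2
      have := (zero_mem_hsum_ofFn_iff h h0 x y π ρ a b c d z hπ.symm hρ.symm).2
        (hp a b c d z (by
          rw [vecCons_injective_iff, ← hr1]
          exact ⟨hd'.2, hi1⟩))
      simp only [← prepend_succ] at this
      exact this
    · intro hp a b c d z hinj
      have hi1 := (vecCons_injective_iff.1 hinj).2
      have hd := (vecCons_injective_iff.1 hinj).1
      rw [← zero_mem_hsum_ofFn_iff h h0 (vecCons a (vecCons b (vecCons c z))) (vecCons d z)
        1 1 a b c d z rfl rfl]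
      have h1 := vecCons_injective_iff.1 hi1
      have h2 := vecCons_injective_iff.1 h1.2
      have h3 := vecCons_injective_iff.1 h2.2
      simp only [range_vecCons, Set.mem_insert_iff, not_or] at h1 h2 h3 hd
      have := hp (vecCons a (vecCons b (vecCons c z))) (vecCons d z) hi1
        (vecCons_injective_iff.2 ⟨hd.2.2.2, h3.2⟩) (by
          have : Set.range (vecCons a (vecCons b (vecCons c z))) \ Set.range (vecCons d z) =
              {a, b, c} := by
            ext t
            simp only [range_vecCons, Set.mem_insert_iff, Set.mem_sdiff, Set.mem_singleton_iff]
            constructor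
            · tauto
            · rintro (rfl | rfl | rfl)
              · exact ⟨by simp, fun hh => hh.elim (fun e => hd.1 e.symm) h1.1.2.2⟩
              · exact ⟨by simp, fun hh => hh.elim (fun e => hd.2.1 e.symm) h2.1.2⟩
              · exact ⟨by simp, fun hh => hh.elim (fun e => hd.2.2.1 e.symm) h3.1⟩
          rw [this]
          exact Set.ncard_eq_three.2 ⟨a, b, c, h1.1.1, h1.1.2.1, h2.1.1, rfl⟩)
      simpa only [prepend_succ] using this

end Plucker

/-! ### Ordered bases, exchanges and circuits of a matroid. -/

section MatroidTuples

variable {E : Type*} {r : ℕ}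

theorem range_update_subset {ι : Type*} [DecidableEq ι] (x : ι → E) (i : ι) (f : E) :
    Set.range (update x i f) ⊆ insert f (Set.range x) := by
  rintro _ ⟨k, rfl⟩
  by_cases hk : k = i
  · subst hk; simp
  · rw [update_of_ne hk]; exact Or.inr ⟨k, rfl⟩

theorem range_subset_insert_update {ι : Type*} [DecidableEq ι] (x : ι → E) (i : ι) (f : E) :
    Set.range x ⊆ insert (x i) (Set.range (update x i f)) := by
  have := range_update_subset (update x i f) i (x i)
  rwa [update_idem, update_eq_self] at this

theorem mem_range_update_of_ne {ι : Type*} [DecidableEq ι] {x : ι → E} {i : ι} {t f : E}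
    (ht : t ∈ Set.range x) (h : t ≠ x i) : t ∈ Set.range (update x i f) :=
  (range_subset_insert_update x i f ht).resolve_left h

/-- A subset of `insert f (range x)` avoiding `x i` lies in the range of the updated tuple. -/
theorem subset_range_update {ι : Type*} [DecidableEq ι] {x : ι → E} {i : ι} {f : E} {C : Set E}
    (hC : C ⊆ insert f (Set.range x)) (h : x i ∉ C) : C ⊆ Set.range (update x i f) := by
  intro t ht
  rcases hC ht with rfl | ht'
  · exact ⟨i, update_self ..⟩
  · exact mem_range_update_of_ne ht' (fun hti => h (hti ▸ ht))

theorem update_injective {ι : Type*} [DecidableEq ι] {x : ι → E} (hx : Injective x) (i : ι)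
    {f : E} (hf : f ∉ Set.range x) : Injective (update x i f) := by
  intro k l hkl
  by_cases hk : k = i <;> by_cases hl : l = i
  · rw [hk, hl]
  · subst hk
    rw [update_self, update_of_ne hl] at hkl
    exact (hf ⟨l, hkl.symm⟩).elim
  · subst hl
    rw [update_self, update_of_ne hk] at hkl
    exact (hf ⟨k, hkl⟩).elim
  · rw [update_of_ne hk, update_of_ne hl] at hkl
    exact hx hkl

theorem range_update_of_injective {ι : Type*} [DecidableEq ι] {x : ι → E} (hx : Injective x)
    (i : ι) (f : E) : Set.range (update x i f) = insert f (Set.range x \ {x i}) := by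
  ext t
  constructor
  · rintro ⟨k, rfl⟩
    by_cases hk : k = i
    · subst hk; simp
    · rw [update_of_ne hk]
      exact Or.inr ⟨⟨k, rfl⟩, fun h => hk (hx h)⟩
  · rintro (rfl | ⟨ht, h⟩)
    · exact ⟨i, update_self ..⟩
    · exact mem_range_update_of_ne ht h

theorem update_update_swap {ι : Type*} [DecidableEq ι] (x : ι → E) {i j : ι} (hij : i ≠ j)
    (a b : E) : update (update x i b) j a = update (update x i a) j b ∘ Equiv.swap i j := by
  funext k
  by_cases hi : k = i
  · subst hi
    simp [hij]
  · by_cases hj : k = j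
    · subst hj
      simp [hij]
    · simp [Equiv.swap_apply_of_ne_of_ne hi hj, hi, hj]

theorem ncard_range_of_injective {x : Fin r → E} (hx : Injective x) :
    (Set.range x).ncard = r := by
  rw [← Set.image_univ, Set.ncard_image_of_injective _ hx]
  simp [Set.ncard_univ]

variable {M : Matroid E}

theorem ncard_of_isBase (hr : M.eRank = r) {B : Set E} (hB : M.IsBase B) : B.ncard = r := by
  rw [Set.ncard_def, hB.encard_eq_eRank, hr]
  simp

theorem injective_of_isBase (hr : M.eRank = r) {x : Fin r → E} (hx : M.IsBase (Set.range x)) :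
    Injective x := by
  have h := ncard_of_isBase hr hx
  rw [← Set.image_univ] at h
  have := (Set.ncard_image_iff (f := x) (s := Set.univ) Set.finite_univ).1
    (by rw [h]; simp [Set.ncard_univ])
  exact Set.injOn_univ.1 this

theorem isBase_range_of_indep (hr : M.eRank = r) {x : Fin r → E} (hx : Injective x)
    (hI : M.Indep (Set.range x)) : M.IsBase (Set.range x) := by
  obtain ⟨B, hB, hs⟩ := hI.exists_isBase_superset
  have hB' : B.encard = r := by rw [hB.encard_eq_eRank, hr]
  have hfin : B.Finite := Set.finite_of_encard_eq_coe hB'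
  rwa [Set.eq_of_subset_of_ncard_le hs
    (by rw [ncard_of_isBase hr hB, ncard_range_of_injective hx]) hfin]

theorem exists_tuple_of_isBase (hr : M.eRank = r) {B : Set E} (hB : M.IsBase B) :
    ∃ x : Fin r → E, Injective x ∧ Set.range x = B := by
  have hB' : B.encard = r := by rw [hB.encard_eq_eRank, hr]
  have hfin : B.Finite := Set.finite_of_encard_eq_coe hB'
  have hn : Nat.card B = r := ncard_of_isBase hr hB
  have := hfin.to_subtype
  refine ⟨fun k => ((Finite.equivFinOfCardEq hn).symm k : E), fun k l hkl => by
    simpa using Subtype.ext hkl, ?_⟩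
  ext t
  constructor
  · rintro ⟨k, rfl⟩
    exact Subtype.mem _
  · intro ht
    exact ⟨Finite.equivFinOfCardEq hn ⟨t, ht⟩, by simp⟩

theorem isCircuit_eq_of_subset_insert {I C D : Set E} {e : E} (hI : M.Indep I)
    (hC : M.IsCircuit C) (hD : M.IsCircuit D) (hCs : C ⊆ insert e I) (hDs : D ⊆ insert e I) :
    C = D :=
  (hC.eq_fundCircuit_of_subset hI hCs).trans (hD.eq_fundCircuit_of_subset hI hDs).symm

theorem not_isCircuit_subset_isBase {B C : Set E} (hB : M.IsBase B) (hC : M.IsCircuit C) :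
    ¬ C ⊆ B :=
  fun h => hC.not_indep (hB.indep.subset h)

theorem exists_isCircuit_subset_of_not_indep (hE : M.E = Set.univ) {D : Set E}
    (hD : ¬ M.Indep D) : ∃ C ⊆ D, M.IsCircuit C := by
  have : M.Dep D := (Matroid.not_indep_iff (by rw [hE]; exact Set.subset_univ _)).1 hD
  exact this.exists_isCircuit_subset

/-- A base plus one element contains only the circuit C, and removing a point of C destroys it. -/
theorem isBase_range_update (hE : M.E = Set.univ) (hr : M.eRank = r) {x : Fin r → E}
    (hx : M.IsBase (Set.range x)) {C : Set E} (hC : M.IsCircuit C) {f : E} {i : Fin r}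
    (hCs : C ⊆ insert f (Set.range x)) (hi : x i ∈ C) : M.IsBase (Set.range (update x i f)) := by
  have hinj := injective_of_isBase hr hx
  have hf : f ∉ Set.range x := fun h =>
    not_isCircuit_subset_isBase hx hC (by rwa [Set.insert_eq_of_mem h] at hCs)
  refine isBase_range_of_indep hr (update_injective hinj i hf) ?_
  by_contra hno
  obtain ⟨D, hDs, hD⟩ := exists_isCircuit_subset_of_not_indep hE hno
  have heq := isCircuit_eq_of_subset_insert hx.indep hC hD hCs
    (hDs.trans (range_update_subset x i f))
  have hmem := hDs (heq ▸ hi)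
  rw [range_update_of_injective hinj] at hmem
  rcases hmem with h | h
  · exact hf ⟨i, h⟩
  · exact h.2 rfl

theorem spanning_sdiff_singleton {U C : Set E} {z : E} (hU : M.Spanning U) (hC : M.IsCircuit C)
    (hCU : C ⊆ U) (hz : z ∈ C) : M.Spanning (U \ {z}) := by
  have hU' : U \ {z} ⊆ M.E := Set.sdiff_subset.trans hU.subset_ground
  rw [Matroid.spanning_iff_closure_eq]
  refine (M.closure_subset_ground _).antisymm ?_
  rw [← hU.closure_eq]
  refine M.closure_subset_closure_of_subset_closure fun t ht => ?_
  by_cases htz : t = z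
  · subst htz
    exact M.closure_subset_closure (Set.sdiff_subset_sdiff_left hCU)
      (hC.mem_closure_sdiff_singleton_of_mem hz)
  · exact M.subset_closure _ hU' ⟨ht, htz⟩

/-- The set U = B ∪ {a, b} has nullity at most 2. If A ∪ D missed a point z of C₁ ∪ C₂, then
removing z, and after it a point of A \ D, would keep U spanning. The result has at most |B|
elements, so it is a base, yet it contains the circuit D. -/
theorem isModularPair_of_subset_insert_insert [Finite E] {B C₁ C₂ : Set E} {a b : E}
    (hE : M.E = Set.univ) (hB : M.IsBase B) (h₁ : M.IsCircuit C₁) (h₂ : M.IsCircuit C₂)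
    (hne : C₁ ≠ C₂) (hs₁ : C₁ ⊆ insert a (insert b B)) (hs₂ : C₂ ⊆ insert a (insert b B)) :
    IsModularPair {C | M.IsCircuit C} C₁ C₂ := by
  refine ⟨h₁, h₂, hne, fun A hA D hD hAD hlt => ?_⟩
  set U := insert a (insert b B) with hU
  have hUs : M.Spanning U := hB.spanning.superset
    ((Set.subset_insert b B).trans (Set.subset_insert a _)) (by rw [hE]; exact Set.subset_univ _)
  obtain ⟨z, hz, hzAD⟩ := Set.exists_of_ssubset hlt
  rw [Set.mem_union, not_or] at hzAD
  have hADU : A ∪ D ⊆ U := hlt.subset.trans (Set.union_subset hs₁ hs₂)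
  have hzU : z ∈ U := Set.union_subset hs₁ hs₂ hz
  have hUz : M.Spanning (U \ {z}) := by
    rcases hz with hz | hz
    · exact spanning_sdiff_singleton hUs h₁ hs₁ hz
    · exact spanning_sdiff_singleton hUs h₂ hs₂ hz
  obtain ⟨g, hgA, hgD⟩ := Set.not_subset.1 fun h => hAD (hD.eq_of_superset_isCircuit hA h).symm
  have hAU : A ⊆ U \ {z} := fun t ht => ⟨hADU (Or.inl ht), fun h => hzAD.1 (h ▸ ht)⟩
  have hW := spanning_sdiff_singleton hUz hA hAU hgA
  obtain ⟨B', hB', hB's⟩ := hW.exists_isBase_subset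
  have hcard : ((U \ {z}) \ {g}).ncard ≤ B'.ncard := by
    rw [Set.ncard_sdiff_singleton_of_mem (hAU hgA), Set.ncard_sdiff_singleton_of_mem hzU,
      hB'.ncard_eq_ncard_of_isBase hB]
    have h1 : U.ncard ≤ (insert b B).ncard + 1 := Set.ncard_insert_le a (insert b B)
    have h2 := Set.ncard_insert_le b B
    omega
  have heq := Set.eq_of_subset_of_ncard_le hB's hcard (Set.toFinite _)
  refine not_isCircuit_subset_isBase hB' hD fun t ht => ?_
  rw [heq]
  exact ⟨⟨hADU (Or.inr ht), fun h => hzAD.2 (h ▸ ht)⟩, fun h => hgD (h ▸ ht)⟩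

/-- Two ordered bases are connected by basis exchanges towards the second one. -/
theorem isBase_tuple_induction (hr : M.eRank = r) {x₀ : Fin r → E}
    (hx₀ : M.IsBase (Set.range x₀)) {P : (Fin r → E) → Prop}
    (hperm : ∀ σ : Equiv.Perm (Fin r), P (x₀ ∘ σ))
    (hstep : ∀ (x : Fin r → E) (i : Fin r) (h : E), M.IsBase (Set.range x) →
      x i ∉ Set.range x₀ → h ∈ Set.range x₀ → h ∉ Set.range x →
      M.IsBase (Set.range (update x i h)) → P (update x i h) → P x)
    (x : Fin r → E) (hx : M.IsBase (Set.range x)) : P x := by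
  suffices H : ∀ n : ℕ, ∀ x : Fin r → E, M.IsBase (Set.range x) →
      (Set.range x \ Set.range x₀).ncard = n → P x from H _ x hx rfl
  intro n
  induction n with
  | zero =>
    intro x hx hn
    rw [Set.ncard_eq_zero ((Set.finite_range x).sdiff), Set.sdiff_eq_empty] at hn
    have heq := Set.eq_of_subset_of_ncard_le hn
      (by rw [ncard_of_isBase hr hx, ncard_of_isBase hr hx₀]) (Set.finite_range x₀)
    obtain ⟨σ, rfl⟩ := exists_perm_of_range_eq (injective_of_isBase hr hx₀)
      (injective_of_isBase hr hx) heq.symm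
    exact hperm σ
  | succ n ih =>
    intro x hx hn
    obtain ⟨g, hg⟩ : (Set.range x \ Set.range x₀).Nonempty :=
      Set.nonempty_of_ncard_ne_zero (by omega)
    obtain ⟨h, hh, hB⟩ := hx.exchange hx₀ hg
    obtain ⟨⟨i, rfl⟩, hi⟩ := hg
    rw [← range_update_of_injective (injective_of_isBase hr hx)] at hB
    refine hstep x i h hx hi hh.1 hh.2 hB (ih _ hB ?_)
    have : Set.range (update x i h) \ Set.range x₀ = (Set.range x \ Set.range x₀) \ {x i} := by
      rw [range_update_of_injective (injective_of_isBase hr hx)]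
      ext t
      simp only [Set.mem_sdiff, Set.mem_insert_iff, Set.mem_singleton_iff]
      constructor
      · rintro ⟨rfl | h1, h2⟩
        · exact (h2 hh.1).elim
        · exact ⟨⟨h1.1, h2⟩, h1.2⟩
      · rintro ⟨⟨h1, h2⟩, h3⟩
        exact ⟨Or.inr ⟨h1, h3⟩, h2⟩
    have hmem : x i ∈ Set.range x \ Set.range x₀ := ⟨⟨i, rfl⟩, hi⟩
    rw [this, Set.ncard_sdiff_singleton_of_mem hmem]
    omega

end MatroidTuples

/-! ### Orthogonality of a vector to a function on ordered bases. -/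

section Orthogonality

variable {F E : Type*} [Hyperfield F] {r : ℕ}

/-- The vector `X` is orthogonal to every `φ(·, y₂, …, y_r)` whose support meets that of `X` in
at most two elements. -/
def IsTwoTermOrthogonal (φ : (Fin r → E) → F) (X : E → F) : Prop :=
  ∀ (x : Fin r → E) (i : Fin r) (e : E), support X ⊆ insert e (Set.range x) →
    X e * φ (update x i e) = -(X (x i) * φ x)

/-- `φ` is antisymmetric and its support consists of the ordered bases of the matroid `M` of
rank `r`. -/
structure IsBaseFunction (M : Matroid E) (φ : (Fin r → E) → F) : Prop where
  ground : M.E = Set.univ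
  eRank : M.eRank = r
  antisymm : IsAntisymm φ
  ne_zero_iff : ∀ x, φ x ≠ 0 ↔ M.IsBase (Set.range x)

variable {M : Matroid E} {φ : (Fin r → E) → F}

theorem IsBaseFunction.eq_zero_of_isCircuit_subset (hφ : IsBaseFunction M φ) {C : Set E}
    (hC : M.IsCircuit C) {x : Fin r → E} (h : C ⊆ Set.range x) : φ x = 0 := by
  by_contra hne
  exact not_isCircuit_subset_isBase ((hφ.ne_zero_iff x).1 hne) hC h

/-- Only exchanges between two bases need checking. If neither tuple is a base, both values of φ
vanish. If just one is, the coordinate of X multiplying its value is zero, since otherwise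
`isBase_range_update` would make the other tuple a base. -/
theorem IsBaseFunction.isTwoTermOrthogonal (hφ : IsBaseFunction M φ) {X : E → F}
    (hX : M.IsCircuit (support X))
    (h : ∀ (x : Fin r → E) (i : Fin r) (e : E), M.IsBase (Set.range x) →
      M.IsBase (Set.range (update x i e)) → x i ≠ e → support X ⊆ insert e (Set.range x) →
      X e * φ (update x i e) = -(X (x i) * φ x)) : IsTwoTermOrthogonal φ X := by
  intro x i e hs
  by_cases hie : x i = e
  · have hx : φ x = 0 := hφ.eq_zero_of_isCircuit_subset hX
      (by rwa [Set.insert_eq_of_mem (hie ▸ Set.mem_range_self i)] at hs)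
    have hu : update x i e = x := by rw [← hie, update_eq_self]
    rw [hu, hx]
    simp
  · by_cases hx : M.IsBase (Set.range x)
    · by_cases hu : M.IsBase (Set.range (update x i e))
      · exact h x i e hx hu hie hs
      · have h1 : φ (update x i e) = 0 := by
          by_contra hne
          exact hu ((hφ.ne_zero_iff _).1 hne)
        have h2 : X (x i) = 0 := by
          by_contra hne
          exact hu (isBase_range_update hφ.ground hφ.eRank hx hX hs hne)
        simp [h1, h2]
    · have h1 : φ x = 0 := by
        by_contra hne
        exact hx ((hφ.ne_zero_iff _).1 hne)
      by_cases hu : M.IsBase (Set.range (update x i e))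
      · have h2 : X e = 0 := by
          by_contra hne
          have := isBase_range_update hφ.ground hφ.eRank hu hX (f := x i) (i := i)
            (hs.trans (Set.insert_subset (Or.inr ⟨i, update_self ..⟩)
              (range_subset_insert_update x i e))) (by simpa using hne)
          rw [update_idem, update_eq_self] at this
          exact hx this
        simp [h1, h2]
      · have h2 : φ (update x i e) = 0 := by
          by_contra hne
          exact hu ((hφ.ne_zero_iff _).1 hne)
        simp [h1, h2]

end Orthogonality

/-! ### From the Plücker relations to circuit vectors and modular elimination. -/

section CircuitsOfPlucker

variable {F E : Type*} [Hyperfield F] {r : ℕ} {M : Matroid E} {φ : (Fin r → E) → F}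

/-- The fundamental circuit of `e₀` in an ordered base `x₀` supports a vector with the correct
ratios for the exchanges of `e₀` with elements of `x₀`. -/
theorem IsBaseFunction.exists_fundamental_vector (hφ : IsBaseFunction M φ) {C : Set E}
    (hC : M.IsCircuit C) {e₀ : E} (he₀ : e₀ ∈ C) {x₀ : Fin r → E}
    (hx₀ : M.IsBase (Set.range x₀)) (hCs : C ⊆ insert e₀ (Set.range x₀)) :
    ∃ X : E → F, support X = C ∧ ∀ i, X e₀ * φ (update x₀ i e₀) = -(X (x₀ i) * φ x₀) := by
  classical
  have hinj := injective_of_isBase hφ.eRank hx₀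
  have he : e₀ ∉ Set.range x₀ := fun h =>
    not_isCircuit_subset_isBase hx₀ hC (by rwa [Set.insert_eq_of_mem h] at hCs)
  have hφ₀ : φ x₀ ≠ 0 := (hφ.ne_zero_iff _).2 hx₀
  -- These coordinates are forced by the normalisation X e₀ = 1. They are nonzero exactly when the
  -- exchange yields a base, that is, when x₀ i ∈ C.
  set g : Fin r → F := fun i => -(φ (update x₀ i e₀) / φ x₀) with hg
  set X : E → F := update (extend x₀ g 0) e₀ 1 with hXdef
  have hX₀ : X e₀ = 1 := update_self ..
  have hXi : ∀ i, X (x₀ i) = g i := by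
    intro i
    rw [hXdef, update_of_ne (fun h => he ⟨i, h⟩), hinj.extend_apply]
  refine ⟨X, ?_, fun i => ?_⟩
  · ext t
    rw [mem_support]
    by_cases ht : t = e₀
    · subst ht
      simp [hX₀, he₀]
    · by_cases htr : t ∈ Set.range x₀
      · obtain ⟨i, rfl⟩ := htr
        have : X (x₀ i) ≠ 0 ↔ φ (update x₀ i e₀) ≠ 0 := by
          rw [hXi, hg]
          simp only [ne_eq, hyperfield_neg_eq_zero, div_eq_zero_iff, hφ₀, or_false]
        rw [this, hφ.ne_zero_iff]
        constructor
        · intro hB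
          by_contra hno
          exact not_isCircuit_subset_isBase hB hC (subset_range_update hCs hno)
        · exact isBase_range_update hφ.ground hφ.eRank hx₀ hC hCs
      · have : X t = 0 := by
          rw [hXdef, update_of_ne ht, extend_apply' _ _ _ (fun h => htr h)]
          rfl
        rw [this]
        simp only [ne_eq, not_true_eq_false, false_iff]
        exact fun h => (hCs h).elim ht htr
  · rw [hX₀, hXi, hg]
    simp only [neg_mul, neg_neg, one_mul]
    rw [div_mul_cancel₀ _ hφ₀]

/-- The ratios of a fundamental vector for exchanges with `e₀` do not depend on the base. -/
theorem IsBaseFunction.fundamental_ratio (hφ : IsBaseFunction M φ) (hp : IsPlucker φ)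
    {X : E → F} (hC : M.IsCircuit (support X)) {e₀ : E} {x₀ : Fin r → E}
    (hx₀ : M.IsBase (Set.range x₀)) (hCs : support X ⊆ insert e₀ (Set.range x₀))
    (hX : ∀ i, X e₀ * φ (update x₀ i e₀) = -(X (x₀ i) * φ x₀)) (x : Fin r → E)
    (hx : M.IsBase (Set.range x)) (hs : support X ⊆ insert e₀ (Set.range x)) (i : Fin r) :
    X e₀ * φ (update x i e₀) = -(X (x i) * φ x) := by
  have he₀ : e₀ ∉ Set.range x₀ := fun h =>
    not_isCircuit_subset_isBase hx₀ hC (by rwa [Set.insert_eq_of_mem h] at hCs)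
  revert hs i
  refine isBase_tuple_induction hφ.eRank hx₀ (P := fun x =>
    support X ⊆ insert e₀ (Set.range x) →
      ∀ i, X e₀ * φ (update x i e₀) = -(X (x i) * φ x)) ?_ ?_ x hx
  · intro σ _ i
    rw [← update_comp_perm, hφ.antisymm.map_perm, hφ.antisymm.map_perm, mul_left_comm, hX]
    rw [mul_neg, mul_left_comm]
    rfl
  · intro x j h hx hj hh hhx hxh ih hs i
    have he : e₀ ∉ Set.range x := fun h =>
      not_isCircuit_subset_isBase hx hC (by rwa [Set.insert_eq_of_mem h] at hs)
    have hjC : x j ∉ support X := by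
      intro hjX
      rcases hCs hjX with h1 | h1
      · exact he ⟨j, h1⟩
      · exact hj h1
    have hzero : φ (update x j e₀) = 0 :=
      hφ.eq_zero_of_isCircuit_subset hC (subset_range_update hs hjC)
    by_cases hij : i = j
    · subst hij
      rw [hzero, notMem_support.1 hjC]
      simp
    · have hs' : support X ⊆ insert e₀ (Set.range (update x j h)) := by
        intro t ht
        rcases hs ht with rfl | h1
        · exact Or.inl rfl
        · exact Or.inr (mem_range_update_of_ne h1 fun h2 => hjC (h2 ▸ ht))
      have h1 := ih hs' i
      rw [update_of_ne hij] at h1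
      -- As x j ∉ supp X, the tuple x[j → e₀] contains the circuit, so one product vanishes. The
      -- hypersum collapses and the relation is an equality that transports the ratio from x[j → h]
      -- to x.
      have h2 := hp x i j e₀ h (injective_of_isBase hφ.eRank hx) hij
        (fun h3 => he₀ (h3 ▸ hh)) he hhx
      rw [hzero, mul_zero, neg_zero, hadd_zero, Set.mem_singleton_iff,
        update_comm hij] at h2
      have h3 : φ (update x j h) ≠ 0 := (hφ.ne_zero_iff _).2 hxh
      apply mul_right_cancel₀ h3
      calc X e₀ * φ (update x i e₀) * φ (update x j h)
          = φ x * (X e₀ * φ (update (update x j h) i e₀)) := by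
            rw [mul_assoc, ← h2]; ac_rfl
        _ = -(X (x i) * φ x) * φ (update x j h) := by
            rw [h1, mul_neg, neg_mul]
            congr 1
            ac_rfl

/-- Every circuit is the support of a vector orthogonal to `φ`. -/
theorem IsBaseFunction.exists_isTwoTermOrthogonal (hφ : IsBaseFunction M φ) (hp : IsPlucker φ)
    {C : Set E} (hC : M.IsCircuit C) : ∃ X : E → F, support X = C ∧ IsTwoTermOrthogonal φ X := by
  obtain ⟨e₀, he₀⟩ := hC.nonempty
  obtain ⟨B, hB, hBs⟩ := (hC.sdiff_singleton_indep he₀).exists_isBase_superset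
  obtain ⟨x₀, -, rfl⟩ := exists_tuple_of_isBase hφ.eRank hB
  have hCs : C ⊆ insert e₀ (Set.range x₀) := by
    intro t ht
    by_cases h : t = e₀
    · exact Or.inl h
    · exact Or.inr (hBs ⟨ht, h⟩)
  obtain ⟨X, rfl, hX⟩ := hφ.exists_fundamental_vector hC he₀ hB hCs
  have key := hφ.fundamental_ratio hp hC hB hCs hX
  refine ⟨X, rfl, hφ.isTwoTermOrthogonal hC fun x i e hx hu hie hs => ?_⟩
  by_cases he : e = e₀
  · subst he
    exact key x hx hs i
  by_cases hi : x i = e₀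
  · have h1 := key (update x i e) hu (by
      rw [← hi]
      exact hs.trans (Set.insert_subset (Or.inr ⟨i, update_self ..⟩)
        (range_subset_insert_update x i e))) i
    rw [update_idem, update_self] at h1
    have h2 : update x i e₀ = x := by rw [← hi, update_eq_self]
    rw [h2] at h1
    rw [hi, h1, neg_neg]
  -- Now e₀ sits at a position j ≠ i of x. The base x[j → e] avoids e₀; putting e₀ at position j
  -- returns x, and putting it at position i gives x[i → e] up to a transposition. The two known
  -- ratios combine to the required one.
  · obtain ⟨j, hj⟩ : e₀ ∈ Set.range x := (hs he₀).resolve_left (Ne.symm he)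
    have hij : i ≠ j := fun h => hi (h ▸ hj)
    have hx1 := isBase_range_update hφ.ground hφ.eRank hx hC (i := j) hs (by rwa [hj])
    have hs1 : support X ⊆ insert e₀ (Set.range (update x j e)) := by
      rw [← hj]
      exact hs.trans (Set.insert_subset (Or.inr ⟨j, update_self ..⟩)
        (range_subset_insert_update x j e))
    have h1 := key _ hx1 hs1 i
    have h2 := key _ hx1 hs1 j
    rw [update_of_ne hij, update_comm hij.symm, update_update_swap x hij,
      hφ.antisymm _ _ _ hij] at h1
    have h3 : update x j e₀ = x := by rw [← hj, update_eq_self]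
    have h4 : update (update x i e) j e₀ = update x i e := by
      rw [← hj, ← update_of_ne hij.symm e x, update_eq_self]
    rw [update_idem, h3, update_self] at h2
    rw [h4] at h1
    have h5 : X e₀ ≠ 0 := he₀
    apply mul_left_cancel₀ h5
    calc X e₀ * (X e * φ (update x i e)) = -(X e * (X e₀ * -φ (update x i e))) := by
          rw [mul_neg, mul_neg, neg_neg]; ac_rfl
      _ = -(X (x i) * -(X e * φ (update x j e))) := by
          rw [h1, mul_neg, mul_neg]; congr 2; ac_rfl
      _ = X e₀ * -(X (x i) * φ x) := by
          rw [← h2, mul_neg]; congr 1; ac_rfl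

/-- Orthogonality at one base containing supp X \ {e} determines every coordinate of X from X e. -/
theorem IsBaseFunction.eq_smul_of_support_subset (hφ : IsBaseFunction M φ) {X Y : E → F}
    (hX : M.IsCircuit (support X)) (hXo : IsTwoTermOrthogonal φ X)
    (hY : M.IsCircuit (support Y)) (hYo : IsTwoTermOrthogonal φ Y)
    (h : support X ⊆ support Y) : ∃ α : Fˣ, X = fun e => (α : F) * Y e := by
  have hXY : support X = support Y := hX.eq_of_subset_isCircuit hY h
  obtain ⟨e, he⟩ := hX.nonempty
  obtain ⟨B, hB, hBs⟩ := (hX.sdiff_singleton_indep he).exists_isBase_superset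
  obtain ⟨x, -, rfl⟩ := exists_tuple_of_isBase hφ.eRank hB
  have hs : support X ⊆ insert e (Set.range x) := by
    intro t ht
    by_cases h : t = e
    · exact Or.inl h
    · exact Or.inr (hBs ⟨ht, h⟩)
  have hXe : X e ≠ 0 := he
  have hYe : Y e ≠ 0 := h he
  refine ⟨Units.mk0 (X e / Y e) (div_ne_zero hXe hYe), funext fun f => ?_⟩
  rw [Units.val_mk0, div_mul_eq_mul_div, eq_div_iff hYe]
  by_cases hf : f ∈ support X
  · rcases hs hf with rfl | ⟨i, rfl⟩
    · rfl
    · have h1 := hXo x i e hs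
      have h2 := hYo x i e (hXY ▸ hs)
      have h3 : φ x ≠ 0 := (hφ.ne_zero_iff x).2 hB
      apply mul_right_cancel₀ h3
      calc X (x i) * Y e * φ x = Y e * (X (x i) * φ x) := by ac_rfl
        _ = Y e * -(X e * φ (update x i e)) := by rw [h1, neg_neg]
        _ = X e * -(Y e * φ (update x i e)) := by rw [mul_neg, mul_neg, mul_left_comm]
        _ = X e * Y (x i) * φ x := by rw [h2, neg_neg, mul_assoc]
  · have hf' : f ∉ support Y := hXY ▸ hf
    rw [notMem_support] at hf hf'
    simp [hf, hf']

/-- Modular elimination for the vectors orthogonal to a function satisfying the `3`-term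
Grassmann–Plücker relations. -/
theorem IsBaseFunction.modular_elimination (hφ : IsBaseFunction M φ) (hp : IsPlucker φ)
    {X Y : E → F} (hX : M.IsCircuit (support X)) (hXo : IsTwoTermOrthogonal φ X)
    (hY : M.IsCircuit (support Y)) (hYo : IsTwoTermOrthogonal φ Y)
    (hm : IsModularPair {C | M.IsCircuit C} (support X) (support Y)) {e : E}
    (hXY : X e = -Y e) (he : X e ≠ 0) :
    ∃ Z : E → F, M.IsCircuit (support Z) ∧ IsTwoTermOrthogonal φ Z ∧ Z e = 0 ∧
      ∀ f, Z f ∈ hadd (X f) (Y f) := by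
  obtain ⟨-, -, hne, hm⟩ := hm
  have hYe : Y e ≠ 0 := fun h => he (by rw [hXY, h, neg_zero])
  obtain ⟨p, hpX, hpY⟩ := Set.not_subset.1 fun h => hne (hX.eq_of_subset_isCircuit hY h)
  obtain ⟨q, hqY, hqX⟩ := Set.not_subset.1 fun h => hne (hY.eq_of_subset_isCircuit hX h).symm
  have hpq : p ≠ q := fun h => hpY (h ▸ hqY)
  -- A circuit A inside this set would violate modularity: A ∪ supp X misses q.
  have hI : M.Indep ((support X ∪ support Y) \ {p, q}) := by
    by_contra hno
    obtain ⟨A, hAs, hA⟩ := exists_isCircuit_subset_of_not_indep hφ.ground hno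
    refine hm A hA _ hX (fun h => (hAs (h ▸ hpX)).2 (Or.inl rfl)) ?_
    refine ⟨Set.union_subset (hAs.trans Set.sdiff_subset) Set.subset_union_left, fun hsub => ?_⟩
    rcases hsub (Or.inr hqY) with h | h
    · exact (hAs h).2 (Or.inr rfl)
    · exact hqX h
  obtain ⟨B, hB, hBs⟩ := hI.exists_isBase_superset
  obtain ⟨x, hinj, rfl⟩ := exists_tuple_of_isBase hφ.eRank hB
  have hmem : ∀ t ∈ support X ∪ support Y, t ≠ p → t ≠ q → t ∈ Set.range x :=
    fun t ht h1 h2 => hBs ⟨ht, fun h => h.elim h1 h2⟩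
  have hXs : support X ⊆ insert p (Set.range x) := by
    intro t ht
    by_cases h : t = p
    · exact Or.inl h
    · exact Or.inr (hmem t (Or.inl ht) h fun h => hqX (h ▸ ht))
  have hYs : support Y ⊆ insert q (Set.range x) := by
    intro t ht
    by_cases h : t = q
    · exact Or.inl h
    · exact Or.inr (hmem t (Or.inr ht) (fun h => hpY (h ▸ ht)) h)
  have hpx : p ∉ Set.range x := fun h =>
    not_isCircuit_subset_isBase hB hX (by rwa [Set.insert_eq_of_mem h] at hXs)
  have hqx : q ∉ Set.range x := fun h =>
    not_isCircuit_subset_isBase hB hY (by rwa [Set.insert_eq_of_mem h] at hYs)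
  obtain ⟨k, rfl⟩ : e ∈ Set.range x := (hXs he).resolve_left fun h => hpY (h ▸ hYe)
  obtain ⟨C, hCs, hC⟩ := hX.elimination hY hne (x k)
  obtain ⟨Z, rfl, hZo⟩ := hφ.exists_isTwoTermOrthogonal hp hC
  -- Modularity forces the eliminated circuit through both p and q: without q its union with supp X
  -- would be too small, and without p its union with supp Y.
  have hqZ : Z q ≠ 0 := by
    intro h0
    refine hm _ hC _ hX (fun h => (hCs (h ▸ he : x k ∈ support Z)).2 rfl) ?_
    refine ⟨Set.union_subset (hCs.trans Set.sdiff_subset) Set.subset_union_left, fun hsub => ?_⟩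
    rcases hsub (Or.inr hqY) with h | h
    · exact h h0
    · exact hqX h
  have hpZ : Z p ≠ 0 := by
    intro h0
    refine hm _ hC _ hY (fun h => (hCs (h ▸ hYe : x k ∈ support Z)).2 rfl) ?_
    refine ⟨Set.union_subset (hCs.trans Set.sdiff_subset) Set.subset_union_right, fun hsub => ?_⟩
    rcases hsub (Or.inl hpX) with h | h
    · exact h h0
    · exact hpY h
  have hXp : X p ≠ 0 := hpX
  have hYq : Y q ≠ 0 := hqY
  set α : F := X p / Z p with hα
  have hα0 : α ≠ 0 := div_ne_zero hXp hpZ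
  set W : E → F := fun f => α * Z f with hW
  have hWs : support W = support Z := by
    ext f
    simp [hW, hα0]
  have hWo : IsTwoTermOrthogonal φ W := by
    intro x i e hs
    rw [hWs] at hs
    simp only [hW, mul_assoc]
    rw [hZo x i e hs, mul_neg]
  have hWe : W (x k) = 0 := by
    have : x k ∉ support W := fun h => (hCs (hWs ▸ h)).2 rfl
    exact notMem_support.1 this
  have hWp : W p = X p := by
    simp only [hW, hα]
    exact div_mul_cancel₀ _ hpZ
  have hx0 : φ x ≠ 0 := (hφ.ne_zero_iff x).2 hB
  have hX1 := hXo x k p hXs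
  have hY1 := hYo x k q hYs
  have hWsub : support W ⊆ insert q (Set.range (update x k p)) := by
    rw [hWs]
    intro t ht
    by_cases h1 : t = q
    · exact Or.inl h1
    · right
      by_cases h2 : t = p
      · exact ⟨k, by rw [h2, update_self]⟩
      · exact mem_range_update_of_ne (hmem t (hCs ht).1 h2 h1) (hCs ht).2
  -- In the base x[k → p], exchanging p for q ties W q to W p = X p. With X e = -Y e this gives W q
  -- = Y q.
  have hW1 := hWo _ k q hWsub
  rw [update_idem, update_self, hWp, hX1, neg_neg, hXY, neg_mul, ← hY1] at hW1
  have hQ1 : φ (update x k q) ≠ 0 := by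
    intro h
    rw [h, mul_zero] at hY1
    exact mul_ne_zero hYe hx0 (hyperfield_neg_eq_zero.1 hY1.symm)
  have hP1 : φ (update x k p) ≠ 0 := by
    intro h
    rw [h, mul_zero] at hX1
    exact mul_ne_zero he hx0 (hyperfield_neg_eq_zero.1 hX1.symm)
  have hWq : W q = Y q := mul_right_cancel₀ hQ1 hW1
  refine ⟨W, hWs ▸ hC, hWo, hWe, fun f => ?_⟩
  by_cases hfe : f = x k
  · subst hfe
    rw [hWe, hXY, hadd_comm]
    exact zero_mem_hadd_neg _
  by_cases hfp : f = p
  · subst hfp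
    rw [notMem_support.1 hpY, hadd_zero, hWp]
    rfl
  by_cases hfq : f = q
  · subst hfq
    rw [notMem_support.1 hqX, zero_hadd, hWq]
    rfl
  by_cases hfx : f ∈ Set.range x
  · obtain ⟨l, rfl⟩ := hfx
    have hlk : l ≠ k := fun h => hfe (h ▸ rfl)
    have hX2 := hXo x l p hXs
    have hY2 := hYo x l q hYs
    have hW2 := hWo _ l q hWsub
    rw [update_of_ne hlk, hWq] at hW2
    -- Multiplied by -Y q, the three products become the common factor φ(x[k → p]) φ(x) times the
    -- coordinates of W, Y and X at x l.
    have hgp := hp x k l p q hinj hlk.symm hpq hpx hqx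
    have h1 := mul_mem_hadd (a := -Y q) hgp
    have e1 : -Y q * (φ x * φ (update (update x k p) l q)) =
        (φ (update x k p) * φ x) * W (x l) := by
      rw [neg_mul, mul_left_comm, hW2, mul_neg, neg_neg]
      ac_rfl
    have e2 : -Y q * (φ (update x k p) * φ (update x l q)) =
        (φ (update x k p) * φ x) * Y (x l) := by
      rw [neg_mul, mul_left_comm, hY2, mul_neg, neg_neg]
      ac_rfl
    have e3 : -Y q * -(φ (update x k q) * φ (update x l p)) =
        (φ (update x k p) * φ x) * X (x l) := by
      rw [neg_mul_neg, ← mul_assoc, hY1, ← neg_mul, ← hXY]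
      calc X (x k) * φ x * φ (update x l p)
          = -(X p * φ (update x k p)) * φ (update x l p) := by rw [hX1, neg_neg]
        _ = φ (update x k p) * -(X p * φ (update x l p)) := by
          rw [neg_mul, mul_neg]; congr 1; ac_rfl
        _ = φ (update x k p) * φ x * X (x l) := by
          rw [hX2, neg_neg]; ac_rfl
    rw [e1, e2, e3, mul_mem_hadd_iff (mul_ne_zero hP1 hx0), hadd_comm] at h1
    exact h1
  · have hfXY : f ∉ support X ∪ support Y := fun h => hfx (hmem f h hfp hfq)
    have h1 : X f = 0 := notMem_support.1 fun h => hfXY (Or.inl h)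
    have h2 : Y f = 0 := notMem_support.1 fun h => hfXY (Or.inr h)
    have h3 : W f = 0 := notMem_support.1 fun h => hfXY (hCs (hWs ▸ h)).1
    rw [h1, h2, h3, zero_hadd]
    rfl

end CircuitsOfPlucker

/-! ### The weak matroid of a weak Grassmann–Plücker function, and injectivity. -/

namespace WeakGP

variable {F E : Type*} [Hyperfield F] {r : ℕ}

theorem isBaseFunction (φ : WeakGP F E r) : IsBaseFunction φ.underlying φ.toFun where
  ground := φ.underlying_ground
  eRank := φ.exists_matroid.choose_spec.2.1
  antisymm := φ.map_swap
  ne_zero_iff x := by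
    rw [φ.underlying_isBase_iff]
    refine ⟨fun h => ⟨x, h, rfl⟩, fun ⟨y, hy, hr⟩ => ?_⟩
    have hyi : Injective y := fun i j hij => by
      by_contra hne
      exact hy (φ.map_eq_zero y i j hne hij)
    have hx : φ.underlying.IsBase (Set.range x) := (φ.underlying_isBase_iff _).2 ⟨y, hy, hr⟩
    obtain ⟨σ, rfl⟩ := exists_perm_of_range_eq hyi
      (injective_of_isBase φ.exists_matroid.choose_spec.2.1 hx) hr
    rw [IsAntisymm.map_perm φ.map_swap]
    exact mul_ne_zero (signIn_ne_zero σ) hy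

theorem isPlucker (φ : WeakGP F E r) : IsPlucker φ.toFun :=
  (IsAntisymm.isPlucker_iff_zero_mem_hsum φ.map_swap φ.map_eq_zero).2 φ.three_term

/-- Clearing denominators turns one condition into the other. The replaced position is moved to the
front by a transposition, whose sign cancels. The denominators are nonzero: X e = 0 would place the
circuit inside a base. -/
theorem mem_circuits_iff (φ : WeakGP F E r) (hr : 0 < r) (X : E → F) :
    X ∈ φ.circuits ↔
      φ.underlying.IsCircuit (support X) ∧ IsTwoTermOrthogonal φ.toFun X := by
  obtain ⟨m, rfl⟩ : ∃ m, r = m + 1 := ⟨r - 1, by omega⟩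
  have hφ := φ.isBaseFunction
  constructor
  · rintro ⟨hC, h⟩
    refine ⟨hC, hφ.isTwoTermOrthogonal hC fun x i e hx hu _ hs => ?_⟩
    obtain ⟨σ, hσ⟩ : ∃ σ : Equiv.Perm (Fin (m + 1)), σ 0 = i := ⟨Equiv.swap 0 i, by simp⟩
    subst hσ
    obtain ⟨a, y, hy⟩ := exists_eq_vecCons (x ∘ σ)
    have ha : x (σ 0) = a := congrFun hy 0
    have h1 : φ.toFun (update x (σ 0) e) = signIn F σ * φ.toFun (vecCons e y) := by
      rw [← update_vecCons_zero a e y, ← hy, ← update_comp_perm, hφ.antisymm.map_perm,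
        ← mul_assoc, signIn_mul_self, one_mul]
    have h2 : φ.toFun x = signIn F σ * φ.toFun (vecCons a y) := by
      rw [← hy, hφ.antisymm.map_perm, ← mul_assoc, signIn_mul_self, one_mul]
    have hr : Set.range x = Set.range (vecCons a y) := by
      rw [← hy, range_comp_perm]
    have h3 := h e a y (by rwa [prepend_succ, ← hr]) (by
      rw [prepend_succ, ← hr]
      rintro t ⟨ht, hte⟩
      exact (hs ht).resolve_left hte)
    simp only [prepend_succ] at h3
    have hXe : X e ≠ 0 := by
      intro h0
      refine not_isCircuit_subset_isBase hx hC fun t ht => (hs ht).resolve_left ?_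
      rintro rfl
      exact ht h0
    have hφa : φ.toFun (vecCons a y) ≠ 0 := by
      rw [hφ.ne_zero_iff, ← hr]
      exact hx
    rw [ha, h1, h2, mul_left_comm, mul_left_comm (X a), ← mul_neg]
    congr 1
    rw [← div_mul_cancel₀ (X a) hXe, h3, neg_mul, neg_mul, neg_neg, mul_right_comm,
      div_mul_cancel₀ _ hφa, mul_comm]
  · rintro ⟨hC, h⟩
    refine ⟨hC, fun e f y hB hs => ?_⟩
    change Fin m → E at y
    simp only [prepend_succ] at hB hs ⊢
    have hs' : support X ⊆ insert e (Set.range (vecCons f y)) := by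
      intro t ht
      by_cases hte : t = e
      · exact Or.inl hte
      · exact Or.inr (hs ⟨ht, hte⟩)
    have h1 := h (vecCons f y) 0 e hs'
    rw [update_vecCons_zero] at h1
    have hXe : X e ≠ 0 := by
      intro h0
      refine not_isCircuit_subset_isBase hB hC fun t ht => hs ⟨ht, ?_⟩
      rintro rfl
      exact ht h0
    have hφf : φ.toFun (vecCons f y) ≠ 0 := (hφ.ne_zero_iff _).2 hB
    rw [div_eq_iff hXe, neg_mul, div_mul_eq_mul_div, mul_comm (φ.toFun _), h1]
    rw [cons_val_zero, neg_div, neg_neg, mul_div_cancel_right₀ _ hφf]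

theorem supports_circuits (φ : WeakGP F E r) (hr : 0 < r) :
    supports φ.circuits = {C | φ.underlying.IsCircuit C} := by
  ext C
  constructor
  · rintro ⟨X, hX, rfl⟩
    exact hX.1
  · intro hC
    obtain ⟨X, rfl, hX⟩ := φ.isBaseFunction.exists_isTwoTermOrthogonal φ.isPlucker hC
    exact ⟨X, (φ.mem_circuits_iff hr X).2 ⟨hC, hX⟩, rfl⟩

/-- The weak matroid of a weak Grassmann–Plücker function. -/
def toWeakMatroid (φ : WeakGP F E r) (hr : 0 < r) : WeakMatroid F E where
  circuits := φ.circuits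
  zero_notMem h := by
    have := h.1.nonempty
    simp at this
  smul_mem X hX α := by
    have hs : support (fun e => (α : F) * X e) = support X := by
      ext f
      simp
    refine ⟨hs ▸ hX.1, fun e f y hB hC => ?_⟩
    rw [hs] at hC
    rw [mul_div_mul_left _ _ α.ne_zero]
    exact hX.2 e f y hB hC
  eq_smul_of_support_subset X hX Y hY h := by
    rw [mem_circuits_iff _ hr] at hX hY
    exact φ.isBaseFunction.eq_smul_of_support_subset hX.1 hX.2 hY.1 hY.2 h
  modular_elimination X hX Y hY hm e he h0 := by
    rw [mem_circuits_iff _ hr] at hX hY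
    rw [φ.supports_circuits hr] at hm
    obtain ⟨Z, hZ, hZo, hZe, hZf⟩ := φ.isBaseFunction.modular_elimination φ.isPlucker
      hX.1 hX.2 hY.1 hY.2 hm he h0
    exact ⟨Z, (φ.mem_circuits_iff hr Z).2 ⟨hZ, hZo⟩, hZe, hZf⟩

theorem underlying_toWeakMatroid [Finite E] (φ : WeakGP F E r) (hr : 0 < r) :
    (φ.toWeakMatroid hr).underlying = φ.underlying := by
  refine Matroid.ext_isCircuit φ.underlying_ground.symm fun C _ => ?_
  rw [WeakMatroid.isCircuit_underlying_iff]
  change C ∈ supports φ.circuits ↔ _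
  rw [φ.supports_circuits hr]
  rfl

theorem rank_toWeakMatroid [Finite E] (φ : WeakGP F E r) (hr : 0 < r) :
    (φ.toWeakMatroid hr).rank = r := by
  rw [WeakMatroid.rank, underlying_toWeakMatroid]
  exact φ.isBaseFunction.eRank

theorem circuits_eq_of_equiv (φ₁ φ₂ : WeakGP F E r) (h : φ₁ ≈ φ₂) :
    φ₁.circuits = φ₂.circuits := by
  obtain ⟨α, h⟩ := h
  have hu : φ₁.underlying = φ₂.underlying := by
    refine Matroid.ext_isBase (by rw [underlying_ground, underlying_ground]) fun B _ => ?_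
    rw [underlying_isBase_iff, underlying_isBase_iff]
    simp [h]
  unfold circuits
  rw [hu]
  simp only [h]
  simp only [mul_div_mul_left _ _ α.ne_zero]

/-- A fundamental circuit vector is orthogonal to both functions, so φ₁/φ₂ does not change under a
base exchange, and it is constant on all ordered bases. -/
theorem equiv_of_circuits_eq [Finite E] (φ₁ φ₂ : WeakGP F E r) (hr : 0 < r)
    (h : φ₁.circuits = φ₂.circuits) : φ₁ ≈ φ₂ := by
  have hu : φ₁.underlying = φ₂.underlying := by
    refine Matroid.ext_isCircuit (by rw [underlying_ground, underlying_ground]) fun C _ => ?_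
    have := φ₁.supports_circuits hr
    rw [h, φ₂.supports_circuits hr] at this
    exact (Set.ext_iff.1 this C).symm
  have hφ₁ := φ₁.isBaseFunction
  have hφ₂ := φ₂.isBaseFunction
  obtain ⟨x₀, hx₀⟩ := φ₂.exists_ne_zero
  have hB₀ := (hφ₂.ne_zero_iff x₀).1 hx₀
  have hx₁ : φ₁.toFun x₀ ≠ 0 := (hφ₁.ne_zero_iff x₀).2 (hu ▸ hB₀)
  refine ⟨Units.mk0 (φ₁.toFun x₀ / φ₂.toFun x₀) (div_ne_zero hx₁ hx₀), funext fun x => ?_⟩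
  rw [Units.val_mk0]
  by_cases hx : φ₂.underlying.IsBase (Set.range x)
  · refine isBase_tuple_induction hφ₂.eRank hB₀ (P := fun x =>
      φ₁.toFun x = φ₁.toFun x₀ / φ₂.toFun x₀ * φ₂.toFun x) (fun σ => ?_) ?_ x hx
    · rw [hφ₁.antisymm.map_perm, hφ₂.antisymm.map_perm, mul_left_comm, div_mul_cancel₀ _ hx₀]
    · intro x i f hx _ _ hf hxf ih
      have hC := hx.fundCircuit_isCircuit (x := f)
        (by rw [underlying_ground]; exact Set.mem_univ f) hf
      obtain ⟨X, hXC, hX⟩ := hφ₂.exists_isTwoTermOrthogonal φ₂.isPlucker hC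
      have hs : support X ⊆ insert f (Set.range x) :=
        hXC ▸ Matroid.fundCircuit_subset_insert ..
      have hX1 : X ∈ φ₁.circuits := by
        rw [h, mem_circuits_iff _ hr, hXC]
        exact ⟨hC, hX⟩
      have h1 := ((mem_circuits_iff _ hr X).1 hX1).2 x i f hs
      have h2 := hX x i f hs
      have hXi : X (x i) ≠ 0 := by
        intro h0
        exact not_isCircuit_subset_isBase hxf (hXC ▸ hC)
          (subset_range_update hs (fun hm => hm h0))
      apply mul_left_cancel₀ hXi
      rw [← neg_neg (X (x i) * φ₁.toFun x), ← h1, ih, mul_left_comm, h2, mul_neg, neg_neg,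
        mul_left_comm]
  · have h1 : φ₁.toFun x = 0 := by
      by_contra h0
      exact hx (hu ▸ (hφ₁.ne_zero_iff x).1 h0)
    have h2 : φ₂.toFun x = 0 := by
      by_contra h0
      exact hx ((hφ₂.ne_zero_iff x).1 h0)
    rw [h1, h2, mul_zero]

end WeakGP

/-! ### Coordinates of an eliminated vector. -/

section Elimination

variable {F E : Type*} [Hyperfield F]

/-- Hypersums with 0 are singletons, so elimination is single-valued wherever one of the two vectors
vanishes. The construction of φ from circuits uses only such coordinates. -/
theorem eq_mul_of_mem_hadd {X Y Z : E → F} {e f : E}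
    (h : Z f ∈ hadd (X f * Y e) (-(Y f * X e))) (hY : Y f = 0) : Z f = X f * Y e := by
  rw [hY, zero_mul, neg_zero, hadd_zero] at h
  exact h

theorem eq_neg_mul_of_mem_hadd {X Y Z : E → F} {e f : E}
    (h : Z f ∈ hadd (X f * Y e) (-(Y f * X e))) (hX : X f = 0) : Z f = -(Y f * X e) := by
  rw [hX, zero_mul, zero_hadd] at h
  exact h

theorem support_subset_of_mem_hadd {X Y Z : E → F} {e : E}
    (h : ∀ f, Z f ∈ hadd (X f * Y e) (-(Y f * X e))) {S : Set E} (hX : support X ⊆ S)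
    (hY : support Y ⊆ S) : support Z ⊆ S := by
  intro f hf
  by_contra hfS
  have h1 : X f = 0 := notMem_support.1 fun h => hfS (hX h)
  have h2 : Y f = 0 := notMem_support.1 fun h => hfS (hY h)
  apply hf
  rw [eq_mul_of_mem_hadd (h f) h2, h1, zero_mul]

end Elimination

/-! ### Circuits of a weak matroid, and values on bases inside a subset. -/

namespace WeakMatroid

variable {F E : Type*} [Hyperfield F] [Finite E] {r : ℕ} (W : WeakMatroid F E)

theorem underlying_ground : W.underlying.E = Set.univ := rfl

theorem supports_eq : supports W.circuits = {C | W.underlying.IsCircuit C} :=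
  Set.ext fun C => (W.isCircuit_underlying_iff C).symm

theorem isCircuit_support {X : E → F} (hX : X ∈ W.circuits) :
    W.underlying.IsCircuit (support X) :=
  (W.isCircuit_underlying_iff _).2 ⟨X, hX, rfl⟩

theorem exists_support_eq {C : Set E} (hC : W.underlying.IsCircuit C) :
    ∃ X ∈ W.circuits, support X = C :=
  (W.isCircuit_underlying_iff C).1 hC

variable {W}

theorem mul_eq_mul_of_subset_insert {B : Set E} (hB : W.underlying.Indep B) {X Y : E → F}
    (hX : X ∈ W.circuits) (hY : Y ∈ W.circuits) {a : E} (hXs : support X ⊆ insert a B)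
    (hYs : support Y ⊆ insert a B) (f g : E) : X f * Y g = X g * Y f := by
  have h := isCircuit_eq_of_subset_insert hB (W.isCircuit_support hX) (W.isCircuit_support hY)
    hXs hYs
  obtain ⟨α, rfl⟩ := W.eq_smul_of_support_subset X hX Y hY h.subset
  dsimp only
  ac_rfl

/-- Elimination of circuits in a set exceeding a base by two elements. -/
theorem elimination_of_subset_insert_insert {B : Set E} (hB : W.underlying.IsBase B)
    {X Y : E → F} (hX : X ∈ W.circuits) (hY : Y ∈ W.circuits) {a b : E}
    (hXs : support X ⊆ insert a (insert b B)) (hYs : support Y ⊆ insert a (insert b B))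
    (hne : support X ≠ support Y) {e : E} (hXe : X e ≠ 0) (hYe : Y e ≠ 0) :
    ∃ Z ∈ W.circuits, Z e = 0 ∧ ∀ f, Z f ∈ hadd (X f * Y e) (-(Y f * X e)) := by
  have hm := isModularPair_of_subset_insert_insert W.underlying_ground hB
    (W.isCircuit_support hX) (W.isCircuit_support hY) hne hXs hYs
  rw [← supports_eq] at hm
  have hnX : -X e ≠ 0 := fun h => hXe (hyperfield_neg_eq_zero.1 h)
  -- Scaling X by Y e and Y by -X e makes the coordinates at e opposite, as modular elimination
  -- requires.
  have h1 := W.smul_mem X hX (Units.mk0 _ hYe)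
  have h2 := W.smul_mem Y hY (Units.mk0 _ hnX)
  have s1 : support (fun f => ((Units.mk0 _ hYe : Fˣ) : F) * X f) = support X := by
    ext f
    simp [hYe]
  have s2 : support (fun f => ((Units.mk0 _ hnX : Fˣ) : F) * Y f) = support Y := by
    ext f
    simp [hyperfield_neg_eq_zero, hXe]
  obtain ⟨Z, hZ, hZe, hZf⟩ := W.modular_elimination _ h1 _ h2 (by rwa [s1, s2]) e
    (by simp [mul_comm]) (by simp [hYe, hXe])
  refine ⟨Z, hZ, hZe, fun f => ?_⟩
  have := hZf f
  simp only [Units.val_mk0, neg_mul] at this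
  rwa [mul_comm (Y e), mul_comm (X e)] at this

/-- A function on the ordered bases contained in `S` with the correct ratios for all
exchanges along circuits contained in `S`. -/
structure IsBaseFunctionOn (W : WeakMatroid F E) (S : Set E) (φ : (Fin r → E) → F) : Prop where
  antisymm : IsAntisymm φ
  ne_zero_iff : ∀ x, φ x ≠ 0 ↔ W.underlying.IsBase (Set.range x) ∧ Set.range x ⊆ S
  exchange : ∀ X ∈ W.circuits, ∀ (x : Fin r → E) (i : Fin r) (f : E),
    W.underlying.IsBase (Set.range x) → Set.range x ⊆ S →
    W.underlying.IsBase (Set.range (update x i f)) → f ∈ S → x i ≠ f →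
    support X ⊆ insert f (Set.range x) → X f * φ (update x i f) = -(X (x i) * φ x)

/-- The only ordered bases here are the rearrangements of x₀, and φ is the sign of the
rearrangement. No exchange condition arises, since a base contains no circuit. -/
theorem exists_isBaseFunctionOn_range (hr : W.rank = r) {x₀ : Fin r → E}
    (hx₀ : W.underlying.IsBase (Set.range x₀)) :
    ∃ φ : (Fin r → E) → F, IsBaseFunctionOn W (Set.range x₀) φ := by
  classical
  have hinj := injective_of_isBase hr hx₀
  let φ : (Fin r → E) → F := fun x =>
    if h : ∃ σ : Equiv.Perm (Fin r), x = x₀ ∘ σ then signIn F h.choose else 0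
  have hφ : ∀ σ : Equiv.Perm (Fin r), φ (x₀ ∘ σ) = signIn F σ := by
    intro σ
    have h : ∃ τ : Equiv.Perm (Fin r), x₀ ∘ σ = x₀ ∘ τ := ⟨σ, rfl⟩
    have : σ = h.choose := by
      ext k
      exact congrArg Fin.val (hinj (congrFun h.choose_spec k))
    simp only [φ]
    rw [dif_pos h, ← this]
  have hφ0 : ∀ x, (¬ ∃ σ : Equiv.Perm (Fin r), x = x₀ ∘ σ) → φ x = 0 := fun x h => dif_neg h
  have hb : ∀ x : Fin r → E, W.underlying.IsBase (Set.range x) → Set.range x ⊆ Set.range x₀ →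
      ∃ σ : Equiv.Perm (Fin r), x = x₀ ∘ σ := fun x hx hs =>
    exists_perm_of_range_eq hinj (injective_of_isBase hr hx)
      (hx.eq_of_subset_isBase hx₀ hs).symm
  refine ⟨φ, ?_, ?_, ?_⟩
  · intro x i j hij
    by_cases h : ∃ σ : Equiv.Perm (Fin r), x = x₀ ∘ σ
    · obtain ⟨σ, rfl⟩ := h
      rw [hφ, Function.comp_assoc, ← Equiv.Perm.coe_mul, hφ, signIn_mul, signIn_swap hij]
      simp
    · rw [hφ0 x h, hφ0, neg_zero]
      rintro ⟨σ, hσ⟩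
      refine h ⟨σ * Equiv.swap i j, ?_⟩
      rw [Equiv.Perm.coe_mul, ← Function.comp_assoc, ← hσ, Function.comp_assoc,
        ← Equiv.Perm.coe_mul, Equiv.swap_mul_self]
      rfl
  · intro x
    constructor
    · intro h
      by_cases hσ : ∃ σ : Equiv.Perm (Fin r), x = x₀ ∘ σ
      · obtain ⟨σ, rfl⟩ := hσ
        rw [range_comp_perm]
        exact ⟨hx₀, subset_rfl⟩
      · exact (h (hφ0 x hσ)).elim
    · rintro ⟨h1, h2⟩
      obtain ⟨σ, rfl⟩ := hb x h1 h2
      rw [hφ]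
      exact signIn_ne_zero σ
  · intro X hX x i f hx hs _ hf _ hXs
    rw [hx.eq_of_subset_isBase hx₀ hs, Set.insert_eq_of_mem hf] at hXs
    exact (not_isCircuit_subset_isBase hx₀ (W.isCircuit_support hX) hXs).elim

/-- The position of `e` in `x`, an element `f ∈ S` and a circuit used to define the value at
the ordered base `x` from the value at an ordered base contained in `S`. -/
structure IsExtensionWitness (W : WeakMatroid F E) (S : Set E) (e : E) (x : Fin r → E)
    (i : Fin r) (f : E) (X : E → F) : Prop where
  apply_eq : x i = e
  mem : f ∈ S
  mem_circuits : X ∈ W.circuits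
  isBase : W.underlying.IsBase (Set.range x)
  isBase_update : W.underlying.IsBase (Set.range (update x i f))
  subset : Set.range (update x i f) ⊆ S
  support_subset : support X ⊆ insert f (Set.range x)

namespace IsExtensionWitness

variable {S : Set E} {e : E} {x : Fin r → E} {i : Fin r} {f : E} {X : E → F}

theorem apply_ne_zero (h : IsExtensionWitness W S e x i f X) : X e ≠ 0 := by
  intro h0
  refine not_isCircuit_subset_isBase h.isBase_update (W.isCircuit_support h.mem_circuits)
    (subset_range_update h.support_subset fun hm => ?_)
  rw [h.apply_eq] at hm
  exact hm h0

theorem notMem_range (h : IsExtensionWitness W S e x i f X) : f ∉ Set.range x := fun hf =>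
  not_isCircuit_subset_isBase h.isBase (W.isCircuit_support h.mem_circuits)
    (by simpa [Set.insert_eq_of_mem hf] using h.support_subset)

theorem ne_zero (h : IsExtensionWitness W S e x i f X) : X f ≠ 0 := by
  intro h0
  refine not_isCircuit_subset_isBase h.isBase (W.isCircuit_support h.mem_circuits)
    fun t ht => (h.support_subset ht).resolve_left ?_
  rintro rfl
  exact ht h0

theorem range_subset (h : IsExtensionWitness W S e x i f X) : Set.range x ⊆ insert e S :=
  (range_subset_insert_update x i f).trans
    (Set.insert_subset (Or.inl h.apply_eq) (h.subset.trans (Set.subset_insert _ _)))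

/-- The values obtained from two witnesses agree. -/
theorem mul_eq_mul (hr : W.rank = r) {φ : (Fin r → E) → F} (hφ : IsBaseFunctionOn W S φ)
    (h : IsExtensionWitness W S e x i f X) {j : Fin r} {g : E} {Y : E → F}
    (h' : IsExtensionWitness W S e x j g Y) :
    Y e * (X f * φ (update x i f)) = X e * (Y g * φ (update x j g)) := by
  obtain rfl : i = j :=
    injective_of_isBase hr h.isBase (h.apply_eq.trans h'.apply_eq.symm)
  by_cases hfg : f = g
  · subst hfg
    rw [← mul_assoc, ← mul_assoc, mul_comm (Y e), mul_eq_mul_of_subset_insert h.isBase.indep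
      h.mem_circuits h'.mem_circuits h.support_subset h'.support_subset]
  · have hYf : Y f = 0 := notMem_support.1 fun hm =>
      (h'.support_subset hm).elim hfg h.notMem_range
    have hXg : X g = 0 := notMem_support.1 fun hm =>
      (h.support_subset hm).elim (Ne.symm hfg) h'.notMem_range
    have hXs : support X ⊆ insert g (insert f (Set.range x)) :=
      h.support_subset.trans (Set.subset_insert _ _)
    have hYs : support Y ⊆ insert g (insert f (Set.range x)) :=
      h'.support_subset.trans (Set.insert_subset_insert (Set.subset_insert _ _))
    -- Eliminating e leaves Z inside S, where φ already has the correct ratio between x[i → f] and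
    -- x[i → g]. Since Y f = 0 and X g = 0, the coordinates Z f and Z g are known exactly.
    obtain ⟨Z, hZ, hZe, hZf⟩ := elimination_of_subset_insert_insert h.isBase h.mem_circuits
      h'.mem_circuits hXs hYs
      (fun heq => (heq ▸ h.ne_zero : f ∈ support Y) hYf)
      h.apply_ne_zero h'.apply_ne_zero
    have hZs : support Z ⊆ insert g (Set.range (update x i f)) := by
      intro t ht
      rcases support_subset_of_mem_hadd hZf hXs hYs ht with rfl | rfl | ht'
      · exact Or.inl rfl
      · exact Or.inr ⟨i, update_self ..⟩
      · refine Or.inr (mem_range_update_of_ne ht' fun hti => ht ?_)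
        rw [hti, h.apply_eq, hZe]
    have := hφ.exchange Z hZ (update x i f) i g h.isBase_update h.subset
      (by rw [update_idem]; exact h'.isBase_update) h'.mem (by rwa [update_self]) hZs
    rw [update_idem, update_self, eq_mul_of_mem_hadd (hZf f) hYf,
      eq_neg_mul_of_mem_hadd (hZf g) hXg, neg_mul] at this
    have := congrArg Neg.neg this
    rw [neg_neg, neg_neg] at this
    calc Y e * (X f * φ (update x i f)) = X f * Y e * φ (update x i f) := by ac_rfl
      _ = X e * (Y g * φ (update x i g)) := by rw [← this]; ac_rfl

end IsExtensionWitness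

end WeakMatroid

/-! ### Extending the function by one element of the ground set. -/

namespace WeakMatroid

variable {F E : Type*} [Hyperfield F] [Finite E] {r : ℕ} {W : WeakMatroid F E} {S : Set E} {e : E}

/-- Base exchange against B₀ ⊆ S replaces e by some f ∈ S; the circuit is the fundamental circuit of
f. -/
theorem exists_isExtensionWitness (hr : W.rank = r) {B₀ : Set E} (hB₀ : W.underlying.IsBase B₀)
    (hB₀S : B₀ ⊆ S) (he : e ∉ S) {x : Fin r → E} (hx : W.underlying.IsBase (Set.range x))
    (hs : Set.range x ⊆ insert e S) (hex : e ∈ Set.range x) :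
    ∃ i f X, IsExtensionWitness W S e x i f X := by
  have hinj := injective_of_isBase hr hx
  obtain ⟨f, ⟨hfB, hfx⟩, hB⟩ := hx.exchange hB₀ ⟨hex, fun h => he (hB₀S h)⟩
  obtain ⟨i, rfl⟩ := hex
  rw [← range_update_of_injective hinj] at hB
  obtain ⟨X, hX, hXs⟩ := W.exists_support_eq (hx.fundCircuit_isCircuit (Set.mem_univ f) hfx)
  refine ⟨i, f, X, rfl, hB₀S hfB, hX, hx, hB, ?_, hXs ▸ Matroid.fundCircuit_subset_insert ..⟩
  rw [range_update_of_injective hinj]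
  rintro t (rfl | ⟨ht, hti⟩)
  · exact hB₀S hfB
  · exact (hs ht).resolve_left hti

/-- `ψ` extends `φ` from the ordered bases contained in `S` to those contained in
`insert e S`. -/
structure IsExtension (W : WeakMatroid F E) (S : Set E) (e : E) (φ ψ : (Fin r → E) → F) :
    Prop where
  eq_of_subset : ∀ x, Set.range x ⊆ S → ψ x = φ x
  mul_eq : ∀ x i f X, IsExtensionWitness W S e x i f X → X e * ψ x = -(X f * φ (update x i f))
  eq_zero : ∀ x, ¬ (W.underlying.IsBase (Set.range x) ∧ Set.range x ⊆ insert e S) → ψ x = 0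

theorem IsBaseFunctionOn.exists_isExtension (hr : W.rank = r) (he : e ∉ S)
    {φ : (Fin r → E) → F} (hφ : IsBaseFunctionOn W S φ) : ∃ ψ, IsExtension W S e φ ψ := by
  have key : ∀ x : Fin r → E, ∃ v : F, (Set.range x ⊆ S → v = φ x) ∧
      (∀ i f X, IsExtensionWitness W S e x i f X → X e * v = -(X f * φ (update x i f))) ∧
      (¬ (W.underlying.IsBase (Set.range x) ∧ Set.range x ⊆ insert e S) → v = 0) := by
    intro x
    by_cases h : ∃ i f X, IsExtensionWitness W S e x i f X
    · obtain ⟨i, f, X, h⟩ := h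
      refine ⟨-(X f * φ (update x i f)) / X e, fun hs => ?_, fun j g Y h' => ?_, fun hno => ?_⟩
      · exact (he (hs ⟨i, h.apply_eq⟩)).elim
      · rw [← mul_div_assoc, div_eq_iff h.apply_ne_zero, mul_neg, h.mul_eq_mul hr hφ h', neg_mul,
          mul_comm (X e)]
      · exact (hno ⟨h.isBase, h.range_subset⟩).elim
    · by_cases hs : Set.range x ⊆ S
      · refine ⟨φ x, fun _ => rfl, fun i f X h' => (h ⟨i, f, X, h'⟩).elim, fun hno => ?_⟩
        by_contra h0
        have := (hφ.ne_zero_iff x).1 h0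
        exact hno ⟨this.1, this.2.trans (Set.subset_insert _ _)⟩
      · exact ⟨0, fun h' => (hs h').elim, fun i f X h' => (h ⟨i, f, X, h'⟩).elim, fun _ => rfl⟩
  choose ψ h1 h2 h3 using key
  exact ⟨ψ, h1, h2, h3⟩

theorem IsExtensionWitness.comp_swap {x : Fin r → E} {k : Fin r} {f : E} {X : E → F}
    (h : IsExtensionWitness W S e x k f X) (i j : Fin r) :
    IsExtensionWitness W S e (x ∘ Equiv.swap i j) (Equiv.swap i j k) f X := by
  have hu : update (x ∘ Equiv.swap i j) (Equiv.swap i j k) f =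
      update x k f ∘ Equiv.swap i j := by
    rw [← update_comp_perm, Equiv.swap_apply_self]
  exact {
    apply_eq := by simp [h.apply_eq]
    mem := h.mem
    mem_circuits := h.mem_circuits
    isBase := by rw [range_comp_perm]; exact h.isBase
    isBase_update := by rw [hu, range_comp_perm]; exact h.isBase_update
    subset := by rw [hu, range_comp_perm]; exact h.subset
    support_subset := by rw [range_comp_perm]; exact h.support_subset }

variable {φ ψ : (Fin r → E) → F}

/-- Exchanges away from the new element `e`. -/
theorem IsExtension.exchange_of_mem (hr : W.rank = r) {B₀ : Set E}
    (hB₀ : W.underlying.IsBase B₀) (hB₀S : B₀ ⊆ S) (he : e ∉ S) (hφ : IsBaseFunctionOn W S φ)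
    (hψ : IsExtension W S e φ ψ) {X : E → F} (hX : X ∈ W.circuits) {x : Fin r → E} {i j : Fin r}
    {h : E} (hx : W.underlying.IsBase (Set.range x)) (hs : Set.range x ⊆ insert e S)
    (hxh : W.underlying.IsBase (Set.range (update x i h))) (hh : h ∈ insert e S) (hih : x i ≠ h)
    (hXs : support X ⊆ insert h (Set.range x)) (hij : i ≠ j) (hj : x j = e) :
    X h * ψ (update x i h) = -(X (x i) * ψ x) := by
  have hinj := injective_of_isBase hr hx
  have hXC := W.isCircuit_support hX
  have hhx : h ∉ Set.range x := fun hm =>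
    not_isCircuit_subset_isBase hx hXC (by rwa [Set.insert_eq_of_mem hm] at hXs)
  have hhe : h ≠ e := fun heq => hhx ⟨j, hj.trans heq.symm⟩
  have hhS : h ∈ S := hh.resolve_left hhe
  have hmem : ∀ t ∈ Set.range x, t ≠ e → t ∈ S := fun t ht hte => (hs ht).resolve_left hte
  have hxi : x i ∈ S := hmem _ ⟨i, rfl⟩ fun heq => hij (hinj (heq.trans hj.symm))
  have hsub : ∀ f ∈ S, Set.range (update x j f) ⊆ S := by
    intro f hf
    rw [range_update_of_injective hinj]
    rintro t (rfl | ⟨ht, htj⟩)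
    · exact hf
    · exact hmem t ht fun h0 => htj (h0.trans hj.symm)
  have hXi : X (x i) ≠ 0 := fun h0 =>
    not_isCircuit_subset_isBase hxh hXC (subset_range_update hXs fun hm => hm h0)
  have hXs' : support X ⊆ insert (x i) (Set.range (update x i h)) :=
    hXs.trans (Set.insert_subset (Or.inr ⟨i, update_self ..⟩) (range_subset_insert_update x i h))
  have hjh : update x i h j = e := by rw [update_of_ne hij.symm, hj]
  -- If e can be exchanged for h, the single vector X serves as witness for both x and x[i → h]: up
  -- to a transposition both reduce to x[j → h].
  by_cases hxj : W.underlying.IsBase (Set.range (update x j h))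
  · have w1 : IsExtensionWitness W S e x j h X :=
      ⟨hj, hhS, hX, hx, hxj, hsub h hhS, hXs⟩
    have hu : update (update x i h) j (x i) = update x j h ∘ Equiv.swap i j := by
      rw [update_update_swap x hij, update_eq_self]
    have w2 : IsExtensionWitness W S e (update x i h) j (x i) X :=
      ⟨hjh, hxi, hX, hxh, by rw [hu, range_comp_perm]; exact hxj,
        by rw [hu, range_comp_perm]; exact hsub h hhS, hXs'⟩
    have e1 := hψ.mul_eq _ _ _ _ w1
    have e2 := hψ.mul_eq _ _ _ _ w2
    rw [hu, hφ.antisymm _ _ _ hij, mul_neg, neg_neg] at e2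
    apply mul_left_cancel₀ w1.apply_ne_zero
    rw [mul_left_comm, e2, mul_neg, mul_left_comm (X e), e1, mul_neg, neg_neg, mul_left_comm]
  -- Otherwise X avoids e. Take a witness Y, f for x, perform the exchange along X inside S after
  -- replacing e by f, and come back with a witness for x[i → h] using the same f.
  · have hXe : X e = 0 := by
      by_contra h0
      exact hxj (isBase_range_update W.underlying_ground hr hx hXC hXs (by rwa [hj]))
    obtain ⟨k, f, Y, w1⟩ := exists_isExtensionWitness hr hB₀ hB₀S he hx hs ⟨j, hj⟩
    obtain rfl : k = j := hinj (w1.apply_eq.trans hj.symm)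
    have hfh : f ≠ h := fun heq => hxj (heq ▸ w1.isBase_update)
    have hXf : X f = 0 := notMem_support.1 fun hm => (hXs hm).elim hfh w1.notMem_range
    have hXs1 : support X ⊆ insert h (Set.range (update x k f)) := by
      intro t ht
      rcases hXs ht with rfl | ht'
      · exact Or.inl rfl
      · refine Or.inr (mem_range_update_of_ne ht' fun htk => ht ?_)
        rw [htk, hj, hXe]
    have hb1 : W.underlying.IsBase (Set.range (update (update x k f) i h)) :=
      isBase_range_update W.underlying_ground hr w1.isBase_update hXC hXs1
        (by rwa [update_of_ne hij])
    have hb1S : Set.range (update (update x k f) i h) ⊆ S :=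
      (range_update_subset _ i h).trans (Set.insert_subset hhS w1.subset)
    have e3 := hφ.exchange X hX (update x k f) i h w1.isBase_update w1.subset hb1 hhS
      (by rwa [update_of_ne hij]) hXs1
    rw [update_of_ne hij] at e3
    have e1 := hψ.mul_eq _ _ _ _ w1
    have e2 : Y e * ψ (update x i h) = -(Y f * φ (update (update x k f) i h)) := by
      by_cases hYi : Y (x i) = 0
      · have hYs : support Y ⊆ insert f (Set.range (update x i h)) := by
          intro t ht
          rcases w1.support_subset ht with rfl | ht'
          · exact Or.inl rfl
          · exact Or.inr (mem_range_update_of_ne ht' fun hti => ht (hti ▸ hYi))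
        have w2 : IsExtensionWitness W S e (update x i h) k f Y :=
          ⟨hjh, w1.mem, w1.mem_circuits, hxh, by rwa [update_comm hij],
            by rwa [update_comm hij], hYs⟩
        have := hψ.mul_eq _ _ _ _ w2
        rwa [update_comm hij] at this
      -- Here Y meets x i, which is missing from x[i → h], so x i is eliminated using X. As X
      -- vanishes at e and f, the result Z is there the multiple of Y by X(x i), and the ratio is
      -- unaffected.
      · have hYs1 : support Y ⊆ insert h (insert f (Set.range x)) :=
          w1.support_subset.trans (Set.subset_insert _ _)
        have hXs2 : support X ⊆ insert h (insert f (Set.range x)) :=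
          hXs.trans (Set.insert_subset_insert (Set.subset_insert _ _))
        obtain ⟨Z, hZ, hZi, hZf⟩ := elimination_of_subset_insert_insert hx w1.mem_circuits hX
          hYs1 hXs2 (fun heq => (heq ▸ w1.ne_zero : f ∈ support X) hXf) hYi hXi
        have hZs : support Z ⊆ insert f (Set.range (update x i h)) := by
          intro t ht
          rcases support_subset_of_mem_hadd hZf hYs1 hXs2 ht with rfl | rfl | ht'
          · exact Or.inr ⟨i, update_self ..⟩
          · exact Or.inl rfl
          · refine Or.inr (mem_range_update_of_ne ht' fun hti => ht ?_)
            rw [hti, hZi]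
        have w2 : IsExtensionWitness W S e (update x i h) k f Z :=
          ⟨hjh, w1.mem, hZ, hxh, by rwa [update_comm hij], by rwa [update_comm hij], hZs⟩
        have := hψ.mul_eq _ _ _ _ w2
        rw [update_comm hij, eq_mul_of_mem_hadd (hZf e) hXe,
          eq_mul_of_mem_hadd (hZf f) hXf] at this
        apply mul_left_cancel₀ hXi
        rw [mul_neg, ← mul_assoc, mul_comm (X _), this, ← mul_assoc, mul_comm (X (x i)) (Y f)]
    apply mul_left_cancel₀ w1.apply_ne_zero
    rw [mul_left_comm, e2, mul_neg, mul_left_comm (X h), e3, mul_neg, neg_neg, mul_neg,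
      mul_left_comm (Y e), e1, mul_neg, neg_neg, mul_left_comm]

/-- An exchange in which e enters or leaves is the defining relation of ψ. If both bases avoid e, it
is the relation for φ; if both contain e, it is `IsExtension.exchange_of_mem`. -/
theorem IsExtension.isBaseFunctionOn (hr : W.rank = r) {B₀ : Set E}
    (hB₀ : W.underlying.IsBase B₀) (hB₀S : B₀ ⊆ S) (he : e ∉ S) (hφ : IsBaseFunctionOn W S φ)
    (hψ : IsExtension W S e φ ψ) : IsBaseFunctionOn W (insert e S) ψ := by
  have hmem : ∀ x : Fin r → E, Set.range x ⊆ insert e S → ¬ Set.range x ⊆ S →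
      e ∈ Set.range x := by
    intro x h1 h2
    obtain ⟨t, ht, htS⟩ := Set.not_subset.1 h2
    exact (h1 ht).resolve_right htS ▸ ht
  refine ⟨fun x i j hij => ?_, fun x => ?_, ?_⟩
  · by_cases hb : W.underlying.IsBase (Set.range x) ∧ Set.range x ⊆ insert e S
    · by_cases hS : Set.range x ⊆ S
      · rw [hψ.eq_of_subset x hS, hψ.eq_of_subset _ (by rwa [range_comp_perm]),
          hφ.antisymm x i j hij]
      · obtain ⟨k, f, X, w⟩ := exists_isExtensionWitness hr hB₀ hB₀S he hb.1 hb.2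
          (hmem x hb.2 hS)
        have e1 := hψ.mul_eq _ _ _ _ w
        have e2 := hψ.mul_eq _ _ _ _ (w.comp_swap i j)
        rw [← update_comp_perm, Equiv.swap_apply_self, hφ.antisymm _ _ _ hij, mul_neg, ← e1] at e2
        apply mul_left_cancel₀ w.apply_ne_zero
        rw [e2, mul_neg]
    · rw [hψ.eq_zero x hb, hψ.eq_zero _ (by rwa [range_comp_perm]), neg_zero]
  · constructor
    · intro h
      by_contra hno
      exact h (hψ.eq_zero x hno)
    · rintro ⟨h1, h2⟩
      by_cases hS : Set.range x ⊆ S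
      · rw [hψ.eq_of_subset x hS]
        exact (hφ.ne_zero_iff x).2 ⟨h1, hS⟩
      · obtain ⟨k, f, X, w⟩ := exists_isExtensionWitness hr hB₀ hB₀S he h1 h2 (hmem x h2 hS)
        intro h0
        have e1 := hψ.mul_eq _ _ _ _ w
        rw [h0, mul_zero] at e1
        exact mul_ne_zero w.ne_zero ((hφ.ne_zero_iff _).2 ⟨w.isBase_update, w.subset⟩)
          (hyperfield_neg_eq_zero.1 e1.symm)
  · intro X hX x i h hx hs hxh hh hih hXs
    have hinj := injective_of_isBase hr hx
    by_cases hex : e ∈ Set.range x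
    · obtain ⟨j, hj⟩ := hex
      by_cases hij : i = j
      · subst hij
        have hhS : h ∈ S := hh.resolve_left fun h0 => hih (hj.trans h0.symm)
        have hsub : Set.range (update x i h) ⊆ S := by
          rw [range_update_of_injective hinj]
          rintro t (rfl | ⟨ht, hti⟩)
          · exact hhS
          · exact (hs ht).resolve_left fun h0 => hti (h0.trans hj.symm)
        have e1 := hψ.mul_eq _ _ _ _ (⟨hj, hhS, hX, hx, hxh, hsub, hXs⟩ :
          IsExtensionWitness W S e x i h X)
        rw [hψ.eq_of_subset _ hsub, hj, e1, neg_neg]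
      · exact hψ.exchange_of_mem hr hB₀ hB₀S he hφ hX hx hs hxh hh hih hXs hij hj
    · have hxS : Set.range x ⊆ S := fun t ht => (hs ht).resolve_left fun h0 => hex (h0 ▸ ht)
      by_cases hhe : h = e
      · subst hhe
        have hu : update (update x i h) i (x i) = x := by rw [update_idem, update_eq_self]
        have e1 := hψ.mul_eq _ _ _ _ (⟨update_self .., hxS ⟨i, rfl⟩, hX, hxh, by rwa [hu],
          by rwa [hu], hXs.trans (Set.insert_subset (Or.inr ⟨i, update_self ..⟩)
            (range_subset_insert_update x i h))⟩ :
          IsExtensionWitness W S h (update x i h) i (x i) X)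
        rw [hu] at e1
        rw [hψ.eq_of_subset x hxS, e1]
      · have hhS : h ∈ S := hh.resolve_left hhe
        rw [hψ.eq_of_subset x hxS, hψ.eq_of_subset _
          ((range_update_subset x i h).trans (Set.insert_subset hhS hxS))]
        exact hφ.exchange X hX x i h hx hxS hxh hhS hih hXs

theorem exists_isBaseFunctionOn_univ (hr : W.rank = r) :
    ∃ φ : (Fin r → E) → F, IsBaseFunctionOn W Set.univ φ := by
  obtain ⟨B, hB⟩ := W.underlying.exists_isBase
  obtain ⟨x₀, -, rfl⟩ := exists_tuple_of_isBase hr hB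
  suffices H : ∀ T : Set E, T.Finite →
      ∃ φ : (Fin r → E) → F, IsBaseFunctionOn W (T ∪ Set.range x₀) φ by
    simpa using H Set.univ Set.finite_univ
  intro T hT
  induction T, hT using Set.Finite.induction_on with
  | empty => simpa using exists_isBaseFunctionOn_range hr hB
  | @insert e T _ _ ih =>
    obtain ⟨φ, hφ⟩ := ih
    rw [Set.insert_union]
    by_cases he : e ∈ T ∪ Set.range x₀
    · rw [Set.insert_eq_of_mem he]
      exact ⟨φ, hφ⟩
    · obtain ⟨ψ, hψ⟩ := hφ.exists_isExtension hr he
      exact ⟨ψ, hψ.isBaseFunctionOn hr hB Set.subset_union_right he hφ⟩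

end WeakMatroid

/-! ### Plücker relations for the constructed function, and surjectivity. -/

namespace WeakMatroid

variable {F E : Type*} [Hyperfield F] [Finite E] {r : ℕ} {W : WeakMatroid F E}
  {φ : (Fin r → E) → F}

theorem IsBaseFunctionOn.isBaseFunction (hr : W.rank = r)
    (hφ : IsBaseFunctionOn W Set.univ φ) : IsBaseFunction W.underlying φ where
  ground := W.underlying_ground
  eRank := hr
  antisymm := hφ.antisymm
  ne_zero_iff x := by simp [hφ.ne_zero_iff]

theorem IsBaseFunctionOn.isTwoTermOrthogonal (hr : W.rank = r)
    (hφ : IsBaseFunctionOn W Set.univ φ) {X : E → F} (hX : X ∈ W.circuits) :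
    IsTwoTermOrthogonal φ X :=
  (hφ.isBaseFunction hr).isTwoTermOrthogonal (W.isCircuit_support hX) fun x i e hx hu hie hs =>
    hφ.exchange X hX x i e hx (Set.subset_univ _) hu (Set.mem_univ _) hie hs

/-- The degenerate Grassmann–Plücker relations, with at most two non-zero terms. -/
theorem mul_eq_mul_of_eq_zero (hφ : IsBaseFunction W.underlying φ)
    (ho : ∀ X ∈ W.circuits, IsTwoTermOrthogonal φ X) {x : Fin r → E} (hx : Injective x)
    (h0 : φ x = 0) {i j : Fin r} (hij : i ≠ j) (c d : E) :
    φ (update x i c) * φ (update x j d) = φ (update x i d) * φ (update x j c) := by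
  have hno : ¬ W.underlying.Indep (Set.range x) := fun hI =>
    (hφ.ne_zero_iff x).2 (isBase_range_of_indep hφ.eRank hx hI) h0
  obtain ⟨C, hCs, hC⟩ := exists_isCircuit_subset_of_not_indep W.underlying_ground hno
  obtain ⟨X, hX, rfl⟩ := W.exists_support_eq hC
  -- The circuit inside the dependent tuple x makes the functions t ↦ φ(x[i → t]) and t ↦ φ(x[j →
  -- t]) proportional, with a ratio independent of t.
  have key : ∀ t, X (x j) * φ (update x i t) = X (x i) * φ (update x j t) := by
    intro t
    have h1 := ho X hX (update x j t) i (x j)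
      (hCs.trans (range_subset_insert_update x j t))
    have h2 : update (update x i t) j (x j) = update x i t := by
      rw [← update_of_ne hij.symm t x, update_eq_self]
    rw [update_of_ne hij, update_comm hij.symm, update_update_swap x hij, h2,
      hφ.antisymm _ _ _ hij, mul_neg] at h1
    rw [← neg_neg (X (x j) * _), h1, neg_neg]
  have hz : ∀ k, X (x k) = 0 → ∀ t, φ (update x k t) = 0 := by
    intro k hk t
    exact hφ.eq_zero_of_isCircuit_subset hC
      (subset_range_update (hCs.trans (Set.subset_insert _ _)) fun hm => hm hk)
  by_cases hi : X (x i) = 0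
  · rw [hz i hi, hz i hi, zero_mul, zero_mul]
  by_cases hj : X (x j) = 0
  · rw [hz j hj, hz j hj, mul_zero, mul_zero]
  apply mul_left_cancel₀ (mul_ne_zero hi hj)
  calc X (x i) * X (x j) * (φ (update x i c) * φ (update x j d))
      = (X (x j) * φ (update x i c)) * (X (x i) * φ (update x j d)) := by ac_rfl
    _ = (X (x i) * φ (update x j c)) * (X (x j) * φ (update x i d)) := by rw [key, key]
    _ = X (x i) * X (x j) * (φ (update x i d) * φ (update x j c)) := by ac_rfl

/-- The fundamental circuits X of d and Y of c in the base x both contain x i. Eliminating x i gives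
Z, and its coordinate at x j lies in a genuine hypersum. Orthogonality of X, Y and Z turns this
membership into the Plücker relation. -/
theorem mem_hadd_of_ne_zero (hφ : IsBaseFunction W.underlying φ)
    (ho : ∀ X ∈ W.circuits, IsTwoTermOrthogonal φ X) {x : Fin r → E} {i j : Fin r} {c d : E}
    (hij : i ≠ j) (hcd : c ≠ d) (hc : c ∉ Set.range x) (hd : d ∉ Set.range x)
    (h0 : φ x ≠ 0) (hic : φ (update x i c) ≠ 0) (hid : φ (update x i d) ≠ 0) :
    φ x * φ (update (update x i c) j d) ∈
      hadd (φ (update x i c) * φ (update x j d)) (-(φ (update x i d) * φ (update x j c))) := by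
  have hx := (hφ.ne_zero_iff x).1 h0
  have hex : ∀ t, t ∉ Set.range x → φ (update x i t) ≠ 0 → ∃ X ∈ W.circuits,
      support X ⊆ insert t (Set.range x) ∧ X t ≠ 0 ∧ X (x i) ≠ 0 := by
    intro t ht hit
    obtain ⟨X, hX, hXC⟩ :=
      W.exists_support_eq (hx.fundCircuit_isCircuit (x := t) (Set.mem_univ t) ht)
    have hXs : support X ⊆ insert t (Set.range x) :=
      hXC ▸ Matroid.fundCircuit_subset_insert ..
    refine ⟨X, hX, hXs, fun hz => ?_, fun hz => ?_⟩
    · exact not_isCircuit_subset_isBase hx (W.isCircuit_support hX)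
        fun s hs => (hXs hs).resolve_left fun hst => hs (hst ▸ hz)
    · exact not_isCircuit_subset_isBase ((hφ.ne_zero_iff _).1 hit) (W.isCircuit_support hX)
        (subset_range_update hXs fun hm => hm hz)
  obtain ⟨X, hX, hXs, hXd, hXi⟩ := hex d hd hid
  obtain ⟨Y, hY, hYs, hYc, hYi⟩ := hex c hc hic
  have hXc : X c = 0 := notMem_support.1 fun hm => (hXs hm).elim hcd hc
  have hYd : Y d = 0 := notMem_support.1 fun hm => (hYs hm).elim hcd.symm hd
  have hXs' : support X ⊆ insert d (insert c (Set.range x)) :=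
    hXs.trans (Set.insert_subset_insert (Set.subset_insert _ _))
  have hYs' : support Y ⊆ insert d (insert c (Set.range x)) :=
    hYs.trans (Set.subset_insert _ _)
  obtain ⟨Z, hZ, hZi, hZf⟩ := elimination_of_subset_insert_insert hx hX hY hXs' hYs'
    (fun heq => (heq ▸ hXd : d ∈ support Y) hYd) hXi hYi
  have hZs : support Z ⊆ insert d (Set.range (update x i c)) := by
    intro t ht
    rcases support_subset_of_mem_hadd hZf hXs' hYs' ht with rfl | rfl | ht'
    · exact Or.inl rfl
    · exact Or.inr ⟨i, update_self ..⟩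
    · exact Or.inr (mem_range_update_of_ne ht' fun hti => ht (hti ▸ hZi))
  have x1 := ho X hX x i d hXs
  have x2 := ho X hX x j d hXs
  have y1 := ho Y hY x i c hYs
  have y2 := ho Y hY x j c hYs
  have z1 := ho Z hZ (update x i c) j d hZs
  rw [update_of_ne hij.symm, eq_mul_of_mem_hadd (hZf d) hYd] at z1
  -- After multiplication by this factor, each term of the relation is -(φ(x[i → c]) φ(x)) times the
  -- matching term of the elimination at x j.
  have hne : X d * Y (x i) ≠ 0 := mul_ne_zero hXd hYi
  rw [← mul_mem_hadd_iff hne]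
  have e1 : X d * Y (x i) * (φ x * φ (update (update x i c) j d)) =
      -(φ (update x i c) * φ x) * Z (x j) := by
    rw [mul_left_comm, z1, mul_neg, neg_mul]; congr 1; ac_rfl
  have e2 : X d * Y (x i) * (φ (update x i c) * φ (update x j d)) =
      -(φ (update x i c) * φ x) * (X (x j) * Y (x i)) := by
    calc _ = Y (x i) * φ (update x i c) * (X d * φ (update x j d)) := by ac_rfl
      _ = _ := by rw [x2, mul_neg, neg_mul]; congr 1; ac_rfl
  have e3 : X d * Y (x i) * -(φ (update x i d) * φ (update x j c)) =
      -(φ (update x i c) * φ x) * -(Y (x j) * X (x i)) := by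
    calc _ = -(Y (x i) * φ (update x j c) * (X d * φ (update x i d))) := by
          rw [mul_neg]; congr 1; ac_rfl
      _ = X (x i) * φ (update x j c) * (Y (x i) * φ x) := by
          rw [x1, mul_neg, neg_neg]; ac_rfl
      _ = X (x i) * φ (update x j c) * -(Y c * φ (update x i c)) := by rw [y1, neg_neg]
      _ = -(X (x i) * φ (update x i c) * (Y c * φ (update x j c))) := by
          rw [mul_neg]; congr 1; ac_rfl
      _ = _ := by rw [y2, mul_neg, neg_mul_neg, neg_neg]; ac_rfl
  rw [e1, e2, e3]
  exact mul_mem_hadd (hZf (x j))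

/-- If φ vanishes at x, x[i → c] or x[i → d], one product drops out. What remains is the two-term
identity `mul_eq_mul_of_eq_zero` for that tuple. -/
theorem isPlucker (hφ : IsBaseFunction W.underlying φ)
    (ho : ∀ X ∈ W.circuits, IsTwoTermOrthogonal φ X) : IsPlucker φ := by
  intro x i j c d hx hij hcd hc hd
  have hxc := update_injective hx i hc
  have hxd := update_injective hx i hd
  by_cases h0 : φ x = 0
  · rw [h0, zero_mul, mul_eq_mul_of_eq_zero hφ ho hx h0 hij]
    exact zero_mem_hadd_neg _
  have hs : ∀ t, φ (update (update x i t) j (x i)) = -φ (update x j t) := fun t => by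
    rw [update_update_swap x hij, update_eq_self, hφ.antisymm _ _ _ hij]
  by_cases hic : φ (update x i c) = 0
  · have := mul_eq_mul_of_eq_zero hφ ho hxc hic hij (x i) d
    rw [update_idem, update_eq_self, update_idem, hs] at this
    rw [this, hic, zero_mul, zero_hadd, mul_neg]
    rfl
  by_cases hid : φ (update x i d) = 0
  · have := mul_eq_mul_of_eq_zero hφ ho hxd hid hij (x i) c
    rw [update_idem, update_eq_self, update_idem, hs, update_update_swap x hij c d,
      hφ.antisymm _ _ _ hij, mul_neg, mul_neg] at this
    rw [hid, zero_mul, neg_zero, hadd_zero, ← neg_neg (φ x * _), this, neg_neg]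
    rfl
  exact mem_hadd_of_ne_zero hφ ho hij hcd hc hd h0 hic hid

/-- The weak Grassmann–Plücker function given by a function on the ordered bases with the
correct ratios. -/
def IsBaseFunctionOn.toWeakGP (hr : W.rank = r) (hφ : IsBaseFunctionOn W Set.univ φ) :
    WeakGP F E r :=
  have h0 : ∀ x i j, i ≠ j → x i = x j → φ x = 0 := fun x i j hij h => by
    by_contra hne
    exact hij (injective_of_isBase hr ((hφ.ne_zero_iff x).1 hne).1 h)
  have hex : ∃ x : Fin r → E, φ x ≠ 0 := by
    obtain ⟨B, hB⟩ := W.underlying.exists_isBase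
    obtain ⟨x, -, rfl⟩ := exists_tuple_of_isBase hr hB
    exact ⟨x, (hφ.ne_zero_iff x).2 ⟨hB, Set.subset_univ _⟩⟩
  { toFun := φ
    exists_ne_zero := hex
    map_swap := hφ.antisymm
    map_eq_zero := h0
    exists_matroid := ⟨W.underlying, W.underlying_ground, hr, fun B => by
      constructor
      · intro hB
        obtain ⟨x, -, rfl⟩ := exists_tuple_of_isBase hr hB
        exact ⟨x, (hφ.ne_zero_iff x).2 ⟨hB, Set.subset_univ _⟩, rfl⟩
      · rintro ⟨x, hx, rfl⟩
        exact ((hφ.ne_zero_iff x).1 hx).1⟩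
    three_term := (IsAntisymm.isPlucker_iff_zero_mem_hsum hφ.antisymm h0).1
      (isPlucker (hφ.isBaseFunction hr) fun _ hX => hφ.isTwoTermOrthogonal hr hX) }

theorem IsBaseFunctionOn.underlying_toWeakGP (hr : W.rank = r)
    (hφ : IsBaseFunctionOn W Set.univ φ) : (hφ.toWeakGP hr).underlying = W.underlying := by
  refine Matroid.ext_isBase (WeakGP.underlying_ground _) fun B _ => ?_
  rw [WeakGP.underlying_isBase_iff]
  constructor
  · rintro ⟨x, hx, rfl⟩
    exact ((hφ.ne_zero_iff x).1 hx).1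
  · intro hB
    obtain ⟨x, -, rfl⟩ := exists_tuple_of_isBase hr hB
    exact ⟨x, (hφ.ne_zero_iff x).2 ⟨hB, Set.subset_univ _⟩, rfl⟩

/-- Orthogonality gives one inclusion. For the other, any vector of 𝒞_φ shares its support with a
circuit of W, which also lies in 𝒞_φ, and vectors there with equal supports are proportional. -/
theorem IsBaseFunctionOn.circuits_toWeakGP (hr0 : 0 < r) (hr : W.rank = r)
    (hφ : IsBaseFunctionOn W Set.univ φ) : (hφ.toWeakGP hr).circuits = W.circuits := by
  have hsub : ∀ X ∈ W.circuits, X ∈ (hφ.toWeakGP hr).circuits := fun X hX => by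
    rw [WeakGP.mem_circuits_iff _ hr0, hφ.underlying_toWeakGP hr]
    exact ⟨W.isCircuit_support hX, hφ.isTwoTermOrthogonal hr hX⟩
  refine Set.Subset.antisymm (fun X hX => ?_) hsub
  have hC := hX.1
  rw [hφ.underlying_toWeakGP hr] at hC
  obtain ⟨Y, hY, hYX⟩ := W.exists_support_eq hC
  obtain ⟨α, rfl⟩ := ((hφ.toWeakGP hr).toWeakMatroid hr0).eq_smul_of_support_subset X hX Y
    (hsub Y hY) hYX.symm.subset
  exact W.smul_mem Y hY α

theorem exists_toWeakMatroid_eq (hr0 : 0 < r) (hr : W.rank = r) :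
    ∃ φ : WeakGP F E r, φ.toWeakMatroid hr0 = W := by
  obtain ⟨φ, hφ⟩ := exists_isBaseFunctionOn_univ hr
  exact ⟨hφ.toWeakGP hr, WeakMatroid.ext (hφ.circuits_toWeakGP hr0 hr)⟩

end WeakMatroid

end HyperfieldMatroid

theorem theorem3p17 {F E : Type*} [Hyperfield F] [Finite E] [Nonempty E] (r : ℕ) (hr : 0 < r) :
    ∃ Φ : HyperfieldMatroid.WeakGPClass F E r ≃
        {M : HyperfieldMatroid.WeakMatroid F E // M.rank = r},
      ∀ φ : HyperfieldMatroid.WeakGP F E r,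
        (Φ (Quotient.mk _ φ)).1.circuits = φ.circuits ∧
        (Φ (Quotient.mk _ φ)).1.underlying = φ.underlying := by
  open HyperfieldMatroid in
  let Ψ : WeakGPClass F E r → {M : WeakMatroid F E // M.rank = r} :=
    Quotient.lift (fun φ => ⟨φ.toWeakMatroid hr, φ.rank_toWeakMatroid hr⟩)
      fun φ₁ φ₂ h => Subtype.ext (WeakMatroid.ext (WeakGP.circuits_eq_of_equiv φ₁ φ₂ h))
  have hΨ : Function.Bijective Ψ := by
    constructor
    · rintro ⟨φ₁⟩ ⟨φ₂⟩ h
      exact Quotient.sound (WeakGP.equiv_of_circuits_eq φ₁ φ₂ hr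
        (congrArg (fun M => M.1.circuits) h))
    · rintro ⟨M, hM⟩
      obtain ⟨φ, hφ⟩ := WeakMatroid.exists_toWeakMatroid_eq hr hM
      exact ⟨Quotient.mk _ φ, Subtype.ext hφ⟩
  exact ⟨Equiv.ofBijective Ψ hΨ, fun φ => ⟨rfl, φ.underlying_toWeakMatroid hr⟩⟩
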